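/- Let $k$ be a field and let $(R,d)$ be a graded-commutative dg-algebra over $k$ graded by the non-negative integers, $R=R^0\oplus R^1\oplus R^2\oplus\cdots$, with differential $d$ of degree $1$. Write $|x|$ for the degree of a homogeneous element $x$. Let $k(1)\subset R^0$ be a Tate line: a one-dimensional $k$-subspace, contained in the center of $R$, with $d\,k(1)=0$, whose non-zero elements are invertible in $R$. Put $k(n)=k(1)^{\otimes n}$ (so $k(0)=k$) and $\overline R=R/k(1)$; all tensor products are over $k$. Let $T(R)=\bigoplus_{m\ge 0}R^{\otimes m}$ and $$\mathcal A_\bullet(R)=T(R)/(k(1)\otimes T(R))=k\oplus\bigoplus_{m\ge 1}\overline R\otimes R^{\otimes(m-1)},$$ graded by $|x_1\otimes\cdots\otimes x_m|=|x_1|+\cdots+|x_m|$, with the additional weight grading $w(x_1\otimes\cdots\otimes x_m)=m+|x_1|+\cdots+|x_m|$, with the deconcatenation coproduct, and with the differential given on homogeneous elements by $$\mathcal D(\bar x_1\otimes x_2\otimes\cdots\otimes x_m)=\sum_{i=1}^{m-1}(-1)^{|x_1|+\cdots+|x_{i-1}|}\,x_1\otimes\cdots\otimes x_{i-1}\otimes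 (dx_i\cdot x_{i+1})\otimes x_{i+2}\otimes\cdots\otimes x_m,$$ where on the right the first tensor factor is taken in $\overline R$ (so $\mathcal D$ vanishes for $m\le 1$). Let $\mathcal A_{>0}=\bigoplus_{m\ge1}\overline R\otimes R^{\otimes (m-1)}=\mathcal A_\bullet(R)/k$, with the restricted coproduct $\Delta'(\bar x_1\otimes\cdots\otimes x_m)=\sum_{0<j<m}(\bar x_1\otimes\cdots\otimes x_j)\otimes(\bar x_{j+1}\otimes\cdots\otimes x_m)$. The cobar complex $\mathrm{Cobar}_\bullet(\mathcal A_\bullet(R))$ is the tensor algebra of $\mathcal A_{>0}[-1]$, in which $[a_1|\cdots|a_l]$ has degree $\sum_r(|a_r|+1)$ and weight $\sum_r w(a_r)$. Its differential is the graded derivation with $[a]\mapsto-[\mathcal D a]+\sum(-1)^{|a'|}[a'|a'']$, where $\Delta' a=\sum a'\otimes a''$; it preserves the weight. Let $\mathrm{Cobar}_n(\mathcal A_\bullet(R))$ be its weight $n$ part. Then for every integer $n\ge 0$ the complex $\mathrm{Cobar}_n(\mathcal A_\bullet(R))$ is quasi-isomorphic, as a complex of $k$-vector spaces, to the weight $n$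 Deligne complex $$k(n)\longrightarrow R^0\xrightarrow{\ d\ }R^1\xrightarrow{\ d\ }\cdots\xrightarrow{\ d\ }R^{n-1},$$ where $k(n)$ is placed in degree $0$, $R^p$ in degree $p+1$ for $0\le p<n$, and the first map is multiplication $t_1\otimes\cdots\otimes t_n\mapsto t_1\cdots t_n$ (for $n=0$ the complex is $k$ in degree $0$). More precisely, there is a morphism of complexes from the Deligne complex to $\mathrm{Cobar}_n(\mathcal A_\bullet(R))$ inducing isomorphisms on cohomology. -/

import Mathlib

open scoped TensorProduct

universe u

noncomputable section

namespace TateDG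

/-! ### Linear maps out of a tensor algebra by recursion on the first letter -/

section Recursion

variable {k : Type*} [CommRing k] {V : Type*} [AddCommGroup V] [Module k V]
  {M : Type*} [AddCommGroup M] [Module k M]

/-- Auxiliary action of a letter `v` on pairs (word, value). -/
def wordStep (P : V →ₗ[k] TensorAlgebra k V →ₗ[k] M) (Q : V →ₗ[k] M →ₗ[k] M) :
    V →ₗ[k] Module.End k (TensorAlgebra k V × M) where
  toFun v :=
    ((LinearMap.mulLeft k (TensorAlgebra.ι k v)).comp (LinearMap.fst k _ _)).prod
      ((P v).comp (LinearMap.fst k _ _) + (Q v).comp (LinearMap.snd k _ _))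
  map_add' v w := by
    ext x <;> simp [add_mul]
  map_smul' c v := by
    ext x <;> simp

theorem wordStep_apply (P : V →ₗ[k] TensorAlgebra k V →ₗ[k] M) (Q : V →ₗ[k] M →ₗ[k] M) (v : V)
    (z : TensorAlgebra k V × M) :
    wordStep P Q v z = (TensorAlgebra.ι k v * z.1, P v z.1 + Q v z.2) := rfl

/-- The linear map `F` on the tensor algebra with `F 1 = m₀` and
`F (v ⊗ w) = P v w + Q v (F w)` for a letter `v` and a word `w`
(see `wordRec_one` and `wordRec_cons`). -/
def wordRec (P : V →ₗ[k] TensorAlgebra k V →ₗ[k] M) (Q : V →ₗ[k] M →ₗ[k] M) (m₀ : M) :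
    TensorAlgebra k V →ₗ[k] M :=
  (LinearMap.snd k _ _).comp
    ((LinearMap.applyₗ ((1 : TensorAlgebra k V), m₀)).comp
      (TensorAlgebra.lift k (wordStep P Q)).toLinearMap)

theorem wordRec_aux (P : V →ₗ[k] TensorAlgebra k V →ₗ[k] M) (Q : V →ₗ[k] M →ₗ[k] M)
    (w : TensorAlgebra k V) : ∀ z : TensorAlgebra k V × M,
    (TensorAlgebra.lift k (wordStep P Q) w z).1 = w * z.1 := by
  induction w using TensorAlgebra.induction with
  | algebraMap r => intro z; simp [Algebra.smul_def]
  | ι v => intro z; simp [wordStep]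
  | mul a b ha hb => intro z; simp [ha, hb, mul_assoc]
  | add a b ha hb => intro z; simp [ha, hb, add_mul]

theorem wordRec_one (P : V →ₗ[k] TensorAlgebra k V →ₗ[k] M) (Q : V →ₗ[k] M →ₗ[k] M) (m₀ : M) :
    wordRec P Q m₀ 1 = m₀ := by
  simp [wordRec]

theorem wordRec_cons (P : V →ₗ[k] TensorAlgebra k V →ₗ[k] M) (Q : V →ₗ[k] M →ₗ[k] M) (m₀ : M)
    (v : V) (w : TensorAlgebra k V) :
    wordRec P Q m₀ (TensorAlgebra.ι k v * w) = P v w + Q v (wordRec P Q m₀ w) := by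
  simp [wordRec, wordStep_apply, wordRec_aux]

theorem word_induction {p : TensorAlgebra k V → Prop} (one : p 1)
    (add : ∀ a b, p a → p b → p (a + b)) (smul : ∀ (c : k) a, p a → p (c • a))
    (cons : ∀ v w, p w → p (TensorAlgebra.ι k v * w)) (w : TensorAlgebra k V) : p w := by
  suffices h : ∀ s, p s → p (w * s) by simpa using h 1 one
  induction w using TensorAlgebra.induction with
  | algebraMap r => intro s hs; simpa [Algebra.smul_def] using smul r s hs
  | ι v => intro s hs; exact cons v s hs
  | mul a b ha hb => intro s hs; rw [mul_assoc]; exact ha _ (hb _ hs)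
  | add a b ha hb => intro s hs; rw [add_mul]; exact add _ _ (ha _ hs) (hb _ hs)

/-- The deconcatenation coproduct
`x₁ ⊗ ⋯ ⊗ xₙ ↦ ∑_{0 ≤ j ≤ n} (x₁ ⊗ ⋯ ⊗ xⱼ) ⨂ (xⱼ₊₁ ⊗ ⋯ ⊗ xₙ)` on the tensor algebra,
given by `Δ 1 = 1 ⨂ 1` and `Δ (v ⊗ w) = 1 ⨂ (v ⊗ w) + (v ⨂ 1) Δ w`. -/
def decon : TensorAlgebra k V →ₗ[k] TensorAlgebra k V ⊗[k] TensorAlgebra k V :=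
  wordRec
    (LinearMap.mk₂ k (fun v w => (1 : TensorAlgebra k V) ⊗ₜ[k] (TensorAlgebra.ι k v * w))
      (by intros; simp [add_mul, TensorProduct.tmul_add])
      (by intros; simp)
      (by intros; simp [mul_add, TensorProduct.tmul_add])
      (by intros; simp))
    ((LinearMap.rTensorHom (TensorAlgebra k V)).comp
      ((LinearMap.mul k (TensorAlgebra k V)).comp (TensorAlgebra.ι k)))
    (1 ⊗ₜ[k] 1)

theorem decon_one : decon (1 : TensorAlgebra k V) = 1 ⊗ₜ[k] 1 := wordRec_one _ _ _

theorem decon_cons (v : V) (w : TensorAlgebra k V) :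
    decon (TensorAlgebra.ι k v * w) = 1 ⊗ₜ[k] (TensorAlgebra.ι k v * w) +
      (LinearMap.mulLeft k (TensorAlgebra.ι k v)).rTensor (TensorAlgebra k V) (decon w) :=
  wordRec_cons _ _ _ _ _

end Recursion

variable {k : Type u} [Field k] {R : Type u} [Ring R] [Algebra k R]

/-! ### Tate dg-algebras -/

/-- A differential on a (possibly non-commutative) algebra graded by the non-negative integers
that makes it a dg-algebra: of degree `1`, of square zero, satisfying the graded Leibniz rule. -/
structure DGAlgebra (𝒜 : ℕ → Submodule k R) [GradedAlgebra 𝒜] where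
  d : R →ₗ[k] R
  d_mem : ∀ {i : ℕ} {x : R}, x ∈ 𝒜 i → d x ∈ 𝒜 (i + 1)
  d_d : ∀ x : R, d (d x) = 0
  leibniz : ∀ {i : ℕ} {x : R}, x ∈ 𝒜 i → ∀ y : R, d (x * y) = d x * y + (-1) ^ i * (x * d y)

/-- A Tate dg-algebra (graded by the non-negative integers): a dg-algebra together with a
Tate line `k(1)`. -/
structure TateDGAlgebra (𝒜 : ℕ → Submodule k R) [GradedAlgebra 𝒜] extends DGAlgebra 𝒜 where
  /-- the Tate line `k(1)` -/
  line : Submodule k R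
  finrank_line : Module.finrank k line = 1
  line_le : line ≤ 𝒜 0
  line_central : ∀ t ∈ line, ∀ x : R, t * x = x * t
  d_line : ∀ t ∈ line, d t = 0
  isUnit_of_mem_line : ∀ t ∈ line, t ≠ 0 → IsUnit t

/-- Graded commutativity: `x y = (-1) ^ (|x| |y|) y x` for homogeneous `x`, `y`. -/
def GradedCommutative (𝒜 : ℕ → Submodule k R) : Prop :=
  ∀ ⦃i j : ℕ⦄ ⦃x y : R⦄, x ∈ 𝒜 i → y ∈ 𝒜 j → x * y = (-1) ^ (i * j) * (y * x)

/-- The linear map `x ↦ (-1) ^ |x| x` on a graded algebra. -/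
def parity (𝒜 : ℕ → Submodule k R) [GradedAlgebra 𝒜] : R →ₗ[k] R :=
  (DirectSum.toModule k ℕ R (fun i => ((-1 : k) ^ i) • (𝒜 i).subtype)).comp
    (DirectSum.decomposeLinearEquiv 𝒜).toLinearMap

section Parity

variable {𝒜 : ℕ → Submodule k R} [GradedAlgebra 𝒜]

theorem parity_of_mem {i : ℕ} {x : R} (hx : x ∈ 𝒜 i) : parity 𝒜 x = (-1 : k) ^ i • x := by
  lift x to 𝒜 i using hx
  simp only [parity, LinearMap.comp_apply, LinearEquiv.coe_coe,
    DirectSum.decomposeLinearEquiv_apply, DirectSum.decompose_coe]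
  erw [DirectSum.toModule_lof]
  rfl

theorem graded_induction {p : R → Prop} (add : ∀ a b, p a → p b → p (a + b)) (zero : p 0)
    (homog : ∀ i, ∀ x ∈ 𝒜 i, p x) (x : R) : p x :=
  DirectSum.Decomposition.inductionOn 𝒜 zero (fun {i} m => homog i m m.2)
    (fun a b => add a b) x

theorem parity_parity (x : R) : parity 𝒜 (parity 𝒜 x) = x := by
  induction x using graded_induction (𝒜 := 𝒜) with
  | add a b ha hb => simp [ha, hb]
  | zero => simp
  | homog i x hx =>
    rw [parity_of_mem hx, map_smul, parity_of_mem hx, smul_smul, ← mul_pow]; simp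

theorem parity_mul (x y : R) : parity 𝒜 (x * y) = parity 𝒜 x * parity 𝒜 y := by
  induction x using graded_induction (𝒜 := 𝒜) with
  | add a b ha hb => simp [add_mul, ha, hb]
  | zero => simp
  | homog i x hx =>
    induction y using graded_induction (𝒜 := 𝒜) with
    | add a b ha hb => simp [mul_add, ha, hb]
    | zero => simp
    | homog j y hy =>
      rw [parity_of_mem hx, parity_of_mem hy, parity_of_mem (SetLike.mul_mem_graded hx hy),
        smul_mul_smul_comm, pow_add]

end Parity

/-! ### The differential on the tensor algebra -/

/-- `leftMul w y = y · w`, where `y ∈ R` multiplies the first letter of the word `w`: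
`y · (x₁ ⊗ x₂ ⊗ ⋯) = (y x₁) ⊗ x₂ ⊗ ⋯`, and `y · 1 = 0` on the empty word. -/
def leftMul : TensorAlgebra k R →ₗ[k] R →ₗ[k] TensorAlgebra k R :=
  wordRec
    (LinearMap.mk₂ k
      (fun v w => ((LinearMap.mul k (TensorAlgebra k R)).flip w).comp
        ((TensorAlgebra.ι k).comp ((LinearMap.mul k R).flip v)))
      (by intros; ext; simp)
      (by intros; ext; simp)
      (by intros; ext; simp)
      (by intros; ext; simp))
    0 0

theorem leftMul_one (y : R) : leftMul (1 : TensorAlgebra k R) y = 0 := by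
  simp [leftMul, wordRec_one]

theorem leftMul_cons (y v : R) (w : TensorAlgebra k R) :
    leftMul (TensorAlgebra.ι k v * w) y = TensorAlgebra.ι k (y * v) * w := by
  simp [leftMul, wordRec_cons]

theorem leftMul_leftMul (y z : R) (w : TensorAlgebra k R) :
    leftMul (leftMul w z) y = leftMul w (y * z) := by
  induction w using word_induction with
  | one => simp [leftMul_one]
  | add a b ha hb => simp [ha, hb]
  | smul c a ha => simp [ha]
  | cons v w hw => simp [leftMul_cons, mul_assoc]

theorem decon_leftMul (y : R) (w : TensorAlgebra k R) :
    decon (leftMul w y) = 1 ⊗ₜ[k] leftMul w y +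
      (leftMul.flip y).rTensor (TensorAlgebra k R) (decon w) := by
  induction w using word_induction with
  | one => simp [leftMul_one, decon_one]
  | add a b ha hb => simp only [map_add, LinearMap.add_apply, ha, hb, TensorProduct.tmul_add]; abel
  | smul c a ha => simp [ha]
  | cons v w hw =>
    have : (leftMul.flip y).comp (LinearMap.mulLeft k (TensorAlgebra.ι k v)) =
        LinearMap.mulLeft k (TensorAlgebra.ι k (y * v)) := by
      ext z; simp [leftMul_cons]
    rw [leftMul_cons, decon_cons, decon_cons, map_add,
      ← LinearMap.comp_apply (LinearMap.rTensor _ (leftMul.flip y)), ← LinearMap.rTensor_comp,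
      this]
    simp [leftMul_one]

/-- `x₁ ⊗ ⋯ ⊗ xₙ ↦ (-1) ^ (|x₁| + ⋯ + |xₙ|) x₁ ⊗ ⋯ ⊗ xₙ` on the tensor algebra. -/
def wordParity (𝒜 : ℕ → Submodule k R) [GradedAlgebra 𝒜] :
    TensorAlgebra k R →ₗ[k] TensorAlgebra k R :=
  (TensorAlgebra.lift k ((TensorAlgebra.ι k).comp (parity 𝒜))).toLinearMap

section WordParity

variable {𝒜 : ℕ → Submodule k R} [GradedAlgebra 𝒜]

theorem wordParity_one : wordParity 𝒜 1 = 1 := by simp [wordParity]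

theorem wordParity_cons (v : R) (w : TensorAlgebra k R) :
    wordParity 𝒜 (TensorAlgebra.ι k v * w) =
      TensorAlgebra.ι k (parity 𝒜 v) * wordParity 𝒜 w := by simp [wordParity]

theorem wordParity_wordParity (w : TensorAlgebra k R) :
    wordParity 𝒜 (wordParity 𝒜 w) = w := by
  induction w using word_induction with
  | one => simp [wordParity_one]
  | add a b ha hb => simp [ha, hb]
  | smul c a ha => simp [ha]
  | cons v w hw => simp [wordParity_cons, parity_parity, hw]

theorem wordParity_leftMul (y : R) (w : TensorAlgebra k R) :
    wordParity 𝒜 (leftMul w y) = leftMul (wordParity 𝒜 w) (parity 𝒜 y) := by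
  induction w using word_induction with
  | one => simp [wordParity_one, leftMul_one]
  | add a b ha hb => simp [ha, hb]
  | smul c a ha => simp [ha]
  | cons v w hw => simp [wordParity_cons, leftMul_cons, parity_mul]

theorem decon_wordParity (w : TensorAlgebra k R) :
    decon (wordParity 𝒜 w) = TensorProduct.map (wordParity 𝒜) (wordParity 𝒜) (decon w) := by
  induction w using word_induction with
  | one => simp [wordParity_one, decon_one]
  | add a b ha hb => simp [ha, hb]
  | smul c a ha => simp [ha]
  | cons v w hw =>
    rw [wordParity_cons, decon_cons, decon_cons, map_add, hw]
    simp only [TensorProduct.map_tmul, wordParity_one, wordParity_cons, add_right_inj]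
    induction decon w with
    | zero => simp
    | tmul a b => simp [wordParity_cons]
    | add a b ha hb => simp only [map_add, ha, hb]

end WordParity

theorem decon_coassoc {V : Type*} [AddCommGroup V] [Module k V] (w : TensorAlgebra k V) :
    TensorProduct.assoc k _ _ _ (decon.rTensor (TensorAlgebra k V) (decon w)) =
      decon.lTensor (TensorAlgebra k V) (decon w) := by
  induction w using word_induction with
  | one => simp [decon_one]
  | add a b ha hb => simp [ha, hb]
  | smul c a ha => simp [ha]
  | cons v w hw =>
    have h1 : ∀ z : TensorAlgebra k V ⊗[k] TensorAlgebra k V,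
        TensorProduct.assoc k _ _ _ (decon.rTensor (TensorAlgebra k V)
          ((LinearMap.mulLeft k (TensorAlgebra.ι k v)).rTensor (TensorAlgebra k V) z)) =
        1 ⊗ₜ (LinearMap.mulLeft k (TensorAlgebra.ι k v)).rTensor (TensorAlgebra k V) z +
        (LinearMap.mulLeft k (TensorAlgebra.ι k v)).rTensor _
          (TensorProduct.assoc k _ _ _ (decon.rTensor (TensorAlgebra k V) z)) := by
      intro z
      induction z with
      | zero => simp
      | add a b ha hb => simp only [map_add, ha, hb, TensorProduct.tmul_add]; abel
      | tmul a b =>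
        simp only [LinearMap.rTensor_tmul, LinearMap.mulLeft_apply, decon_cons,
          TensorProduct.add_tmul, map_add, TensorProduct.assoc_tmul, add_right_inj]
        induction decon a with
        | zero => simp
        | add a b ha hb => simp only [map_add, TensorProduct.add_tmul, ha, hb]
        | tmul a b => simp
    have h2 : ∀ z : TensorAlgebra k V ⊗[k] TensorAlgebra k V,
        decon.lTensor (TensorAlgebra k V)
          ((LinearMap.mulLeft k (TensorAlgebra.ι k v)).rTensor (TensorAlgebra k V) z) =
        (LinearMap.mulLeft k (TensorAlgebra.ι k v)).rTensor _
          (decon.lTensor (TensorAlgebra k V) z) := by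
      intro z
      induction z with
      | zero => simp
      | add a b ha hb => simp only [map_add, ha, hb]
      | tmul a b => simp
    rw [decon_cons, map_add, map_add, map_add, h1, h2, hw, LinearMap.rTensor_tmul, decon_one,
      TensorProduct.assoc_tmul, LinearMap.lTensor_tmul, decon_cons, TensorProduct.tmul_add]
    abel

namespace DGAlgebra

variable {𝒜 : ℕ → Submodule k R} [GradedAlgebra 𝒜] (S : DGAlgebra 𝒜)

theorem d_mul (x y : R) : S.d (x * y) = S.d x * y + parity 𝒜 x * S.d y := by
  induction x using graded_induction (𝒜 := 𝒜) with
  | add a b ha hb => simp only [add_mul, map_add, ha, hb]; abel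
  | zero => simp
  | homog i x hx =>
    rw [S.leibniz hx, parity_of_mem hx]
    rcases Nat.even_or_odd i with h | h <;> simp [h]

theorem parity_d (x : R) : parity 𝒜 (S.d x) = -S.d (parity 𝒜 x) := by
  induction x using graded_induction (𝒜 := 𝒜) with
  | add a b ha hb => simp only [map_add, ha, hb, neg_add]
  | zero => simp
  | homog i x hx => simp [parity_of_mem hx, parity_of_mem (S.d_mem hx), pow_succ]

/-- The map `𝓓` on the tensor algebra of `R`, by recursion on the length of words:
`𝓓 (x₁ ⊗ x₂ ⊗ ⋯ ⊗ xₙ) = (d x₁ · x₂) ⊗ x₃ ⊗ ⋯ ⊗ xₙ + (-1) ^ |x₁| x₁ ⊗ 𝓓 (x₂ ⊗ ⋯ ⊗ xₙ)`;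
it vanishes on words of length `0` and `1`. -/
def wordD : TensorAlgebra k R →ₗ[k] TensorAlgebra k R :=
  wordRec (leftMul.flip.comp S.d)
    ((LinearMap.mul k (TensorAlgebra k R)).comp ((TensorAlgebra.ι k).comp (parity 𝒜))) 0

theorem wordD_one : S.wordD 1 = 0 := wordRec_one _ _ _

theorem wordD_cons (v : R) (w : TensorAlgebra k R) :
    S.wordD (TensorAlgebra.ι k v * w) =
      leftMul w (S.d v) + TensorAlgebra.ι k (parity 𝒜 v) * S.wordD w :=
  wordRec_cons _ _ _ _ _

theorem wordD_leftMul (y : R) (w : TensorAlgebra k R) :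
    S.wordD (leftMul w (S.d y)) = -leftMul (S.wordD w) (S.d (parity 𝒜 y)) := by
  induction w using word_induction with
  | one => simp [leftMul_one, wordD_one]
  | add a b ha hb => simp only [map_add, LinearMap.add_apply, ha, hb, neg_add]
  | smul c a ha => simp [ha]
  | cons v w hw =>
    simp only [leftMul_cons, wordD_cons, map_add, LinearMap.add_apply, d_mul, d_d, zero_mul,
      zero_add, parity_mul, parity_d, leftMul_leftMul, neg_mul, map_neg]
    abel

theorem wordD_wordD (w : TensorAlgebra k R) : S.wordD (S.wordD w) = 0 := by
  induction w using word_induction with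
  | one => simp [wordD_one]
  | add a b ha hb => simp [ha, hb]
  | smul c a ha => simp [ha]
  | cons v w hw => simp [wordD_cons, wordD_leftMul, hw]

theorem wordParity_wordD (w : TensorAlgebra k R) :
    wordParity 𝒜 (S.wordD w) = -S.wordD (wordParity 𝒜 w) := by
  induction w using word_induction with
  | one => simp [wordD_one, wordParity_one]
  | add a b ha hb => simp only [map_add, ha, hb, neg_add]
  | smul c a ha => simp [ha]
  | cons v w hw =>
    simp only [wordD_cons, wordParity_cons, map_add, wordParity_leftMul, parity_d, hw, map_neg]
    simp only [mul_neg]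
    abel

theorem decon_wordD (w : TensorAlgebra k R) :
    decon (S.wordD w) = S.wordD.rTensor (TensorAlgebra k R) (decon w) +
      TensorProduct.map (wordParity 𝒜) S.wordD (decon w) := by
  induction w using word_induction with
  | one => simp [wordD_one, decon_one]
  | add a b ha hb => simp only [map_add, ha, hb]; abel
  | smul c a ha => simp [ha]
  | cons v w hw =>
    have h : ∀ z : TensorAlgebra k R ⊗[k] TensorAlgebra k R,
        S.wordD.rTensor (TensorAlgebra k R)
          ((LinearMap.mulLeft k (TensorAlgebra.ι k v)).rTensor (TensorAlgebra k R) z) +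
        TensorProduct.map (wordParity 𝒜) S.wordD
          ((LinearMap.mulLeft k (TensorAlgebra.ι k v)).rTensor (TensorAlgebra k R) z) =
        (leftMul.flip (S.d v)).rTensor (TensorAlgebra k R) z +
        (LinearMap.mulLeft k (TensorAlgebra.ι k (parity 𝒜 v))).rTensor (TensorAlgebra k R)
          (S.wordD.rTensor (TensorAlgebra k R) z +
            TensorProduct.map (wordParity 𝒜) S.wordD z) := by
      intro z
      induction z with
      | zero => simp
      | add a b ha hb =>
        simp only [map_add] at ha hb ⊢
        rw [add_add_add_comm, ha, hb]; abel
      | tmul a b =>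
        simp [wordD_cons, wordParity_cons, TensorProduct.add_tmul]
        abel
    have h' := h (decon w)
    rw [wordD_cons, map_add, decon_leftMul, decon_cons, hw, decon_cons,
      map_add (S.wordD.rTensor (TensorAlgebra k R)),
      map_add (TensorProduct.map (wordParity 𝒜) S.wordD),
      add_add_add_comm (S.wordD.rTensor (TensorAlgebra k R) _), h']
    simp only [LinearMap.rTensor_tmul, wordD_one, TensorProduct.zero_tmul,
      TensorProduct.map_tmul, wordParity_one, wordD_cons, TensorProduct.tmul_add]
    abel

end DGAlgebra

/-! ### The weight and the degree of words -/

/-- `IsWord 𝒜 n j w`: `w = x₁ ⊗ ⋯ ⊗ xₘ` with homogeneous letters `xᵢ`, of weight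
`n = m + |x₁| + ⋯ + |xₘ|` and degree `j = |x₁| + ⋯ + |xₘ|`. -/
inductive IsWord (𝒜 : ℕ → Submodule k R) : ℕ → ℕ → TensorAlgebra k R → Prop
  | nil : IsWord 𝒜 0 0 1
  | cons {a n j : ℕ} {x : R} {w : TensorAlgebra k R} (hx : x ∈ 𝒜 a) (hw : IsWord 𝒜 n j w) :
      IsWord 𝒜 (1 + a + n) (a + j) (TensorAlgebra.ι k x * w)

/-- The part of weight `n` and degree `j` of the tensor algebra of `R`. -/
def wordPart (𝒜 : ℕ → Submodule k R) (n j : ℕ) : Submodule k (TensorAlgebra k R) :=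
  Submodule.span k {w | IsWord 𝒜 n j w}

section WordPart

variable {𝒜 : ℕ → Submodule k R}

theorem IsWord.mem {n j : ℕ} {w : TensorAlgebra k R} (hw : IsWord 𝒜 n j w) :
    w ∈ wordPart 𝒜 n j := Submodule.subset_span hw

theorem wordPart_congr {n n' j j' : ℕ} {w : TensorAlgebra k R} (hw : w ∈ wordPart 𝒜 n j)
    (hn : n = n') (hj : j = j') : w ∈ wordPart 𝒜 n' j' := by
  subst hn hj; exact hw

theorem wordPart_cons {a n j : ℕ} {x : R} {w : TensorAlgebra k R} (hx : x ∈ 𝒜 a)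
    (hw : w ∈ wordPart 𝒜 n j) :
    TensorAlgebra.ι k x * w ∈ wordPart 𝒜 (1 + a + n) (a + j) := by
  induction hw using Submodule.span_induction with
  | mem w hw => exact Submodule.subset_span (.cons hx hw)
  | zero => simp
  | add u v _ _ hu hv => rw [mul_add]; exact add_mem hu hv
  | smul c u _ hu => rw [mul_smul_comm]; exact Submodule.smul_mem _ _ hu

variable [GradedAlgebra 𝒜]

theorem leftMul_mem {b n j : ℕ} {y : R} {w : TensorAlgebra k R} (hy : y ∈ 𝒜 b)
    (hw : IsWord 𝒜 n j w) : leftMul w y ∈ wordPart 𝒜 (b + n) (b + j) := by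
  cases hw with
  | nil => simp [leftMul_one]
  | @cons a n j x w hx hw =>
    rw [leftMul_cons]
    exact wordPart_congr (wordPart_cons (SetLike.mul_mem_graded hy hx) hw.mem)
      (by omega) (by omega)

theorem wordParity_mem {n j : ℕ} {w : TensorAlgebra k R} (hw : IsWord 𝒜 n j w) :
    wordParity 𝒜 w ∈ wordPart 𝒜 n j := by
  induction hw with
  | nil => rw [wordParity_one]; exact Submodule.subset_span .nil
  | cons hx hw ih =>
    rw [wordParity_cons, parity_of_mem hx]
    exact wordPart_cons (Submodule.smul_mem _ _ hx) ih

theorem wordD_mem (S : DGAlgebra 𝒜) {n j : ℕ} {w : TensorAlgebra k R} (hw : IsWord 𝒜 n j w) :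
    S.wordD w ∈ wordPart 𝒜 n (j + 1) := by
  induction hw with
  | nil => simp [DGAlgebra.wordD_one]
  | @cons a n j x w hx hw ih =>
    rw [DGAlgebra.wordD_cons, parity_of_mem hx]
    refine add_mem ?_ ?_
    · exact wordPart_congr (leftMul_mem (S.d_mem hx) hw) (by omega) (by omega)
    · exact wordPart_congr (wordPart_cons (Submodule.smul_mem _ _ hx) ih) rfl (by omega)

theorem decon_mem {n j : ℕ} {w : TensorAlgebra k R} (hw : IsWord 𝒜 n j w) :
    decon w ∈ Submodule.span k {z | ∃ n₁ j₁ n₂ j₂ u v, IsWord 𝒜 n₁ j₁ u ∧ IsWord 𝒜 n₂ j₂ v ∧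
      n₁ + n₂ = n ∧ j₁ + j₂ = j ∧ z = u ⊗ₜ[k] v} := by
  induction hw with
  | nil =>
    rw [decon_one]
    exact Submodule.subset_span ⟨0, 0, 0, 0, 1, 1, .nil, .nil, rfl, rfl, rfl⟩
  | @cons a n j x w hx hw ih =>
    rw [decon_cons]
    refine add_mem (Submodule.subset_span
      ⟨0, 0, _, _, 1, _, .nil, .cons hx hw, by simp, by simp, rfl⟩) ?_
    generalize decon w = z at ih
    induction ih using Submodule.span_induction with
    | mem z hz =>
      obtain ⟨n₁, j₁, n₂, j₂, u, v, hu, hv, rfl, rfl, rfl⟩ := hz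
      exact Submodule.subset_span
        ⟨_, _, _, _, _, v, .cons hx hu, hv, by omega, by omega, by simp⟩
    | zero => simp
    | add u v _ _ hu hv => rw [map_add]; exact add_mem hu hv
    | smul c u _ hu => rw [map_smul]; exact Submodule.smul_mem _ _ hu

end WordPart

namespace TateDGAlgebra

variable {𝒜 : ℕ → Submodule k R} [GradedAlgebra 𝒜] (S : TateDGAlgebra 𝒜)

/-! ### The dg-coalgebra `𝓐(R)` -/

/-- The right ideal `k(1) ⊗ T(R)` of the tensor algebra `T(R)`. -/
def tateIdeal : Submodule k (TensorAlgebra k R) :=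
  S.line.map (TensorAlgebra.ι k) * ⊤

/-- The space `𝓐(R) = T(R) / (k(1) ⊗ T(R))`; its component of length `n ≥ 1` is
`(R / k(1)) ⊗ R ⊗ ⋯ ⊗ R` with `n` factors. -/
abbrev A : Type u := TensorAlgebra k R ⧸ S.tateIdeal

theorem tateIdeal_le {M : Type*} [AddCommGroup M] [Module k M] (f : TensorAlgebra k R →ₗ[k] M)
    (h : ∀ t ∈ S.line, ∀ w, f (TensorAlgebra.ι k t * w) = 0) :
    S.tateIdeal ≤ LinearMap.ker f := by
  rw [tateIdeal, Submodule.mul_le]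
  rintro _ ⟨t, ht, rfl⟩ w -
  exact h t ht w

theorem cons_mem_tateIdeal {t : R} (ht : t ∈ S.line) (w : TensorAlgebra k R) :
    TensorAlgebra.ι k t * w ∈ S.tateIdeal :=
  Submodule.mul_mem_mul (Submodule.mem_map_of_mem ht) Submodule.mem_top

theorem parity_line {t : R} (ht : t ∈ S.line) : parity 𝒜 t = t := by
  simpa using parity_of_mem (S.line_le ht)

/-- The coproduct of `𝓐(R)`, induced by deconcatenation. -/
def comul : S.A →ₗ[k] S.A ⊗[k] S.A :=
  S.tateIdeal.liftQ ((TensorProduct.map S.tateIdeal.mkQ S.tateIdeal.mkQ).comp decon) <|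
    S.tateIdeal_le _ fun t ht w => by
      have h : ∀ z, TensorProduct.map S.tateIdeal.mkQ S.tateIdeal.mkQ
          ((LinearMap.mulLeft k (TensorAlgebra.ι k t)).rTensor (TensorAlgebra k R) z) = 0 := by
        intro z
        induction z with
        | zero => simp
        | add a b ha hb => simp only [map_add, ha, hb, add_zero]
        | tmul a b =>
          have := (Submodule.Quotient.mk_eq_zero S.tateIdeal).2 (S.cons_mem_tateIdeal ht a)
          simp [this]
      have := (Submodule.Quotient.mk_eq_zero S.tateIdeal).2 (S.cons_mem_tateIdeal ht w)
      simp [decon_cons, h, this]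

/-- The differential `𝓓` of `𝓐(R)`:
`𝓓 (x̄₁ ⊗ x₂ ⊗ ⋯ ⊗ xₙ) = d x̄₁ · x₂ ⊗ x₃ ⊗ ⋯ ⊗ xₙ + (-1) ^ |x₁| x̄₁ ⊗ 𝓓 (x₂ ⊗ ⋯ ⊗ xₙ)`. -/
def D : S.A →ₗ[k] S.A :=
  S.tateIdeal.mapQ S.tateIdeal S.wordD <| by
    have := S.tateIdeal_le (S.tateIdeal.mkQ.comp S.wordD) fun t ht w => by
      simp [DGAlgebra.wordD_cons, S.d_line t ht, S.parity_line ht, S.cons_mem_tateIdeal ht]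
    rwa [LinearMap.ker_comp, Submodule.ker_mkQ] at this

/-- `a ↦ (-1) ^ |a| a` on `𝓐(R)`. -/
def parityA : S.A →ₗ[k] S.A :=
  S.tateIdeal.mapQ S.tateIdeal (wordParity 𝒜) <| by
    have := S.tateIdeal_le (S.tateIdeal.mkQ.comp (wordParity 𝒜)) fun t ht w => by
      simp [wordParity_cons, S.parity_line ht, S.cons_mem_tateIdeal ht]
    rwa [LinearMap.ker_comp, Submodule.ker_mkQ] at this

/-- The line `𝓐₀ = k` in `𝓐(R)` spanned by the empty word. -/
def unitLine : Submodule k S.A := Submodule.span k {S.tateIdeal.mkQ 1}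

/-- `𝓐(R) / 𝓐₀`, isomorphic to `⨁_{n ≥ 1} 𝓐ₙ(R)`. -/
abbrev RedA : Type u := S.A ⧸ S.unitLine

theorem unitLine_le {M : Type*} [AddCommGroup M] [Module k M] (f : S.A →ₗ[k] M)
    (h : f (S.tateIdeal.mkQ 1) = 0) : S.unitLine ≤ LinearMap.ker f := by
  rw [unitLine, Submodule.span_le, Set.singleton_subset_iff]
  exact h

theorem mk_unit : S.unitLine.mkQ (S.tateIdeal.mkQ 1) = 0 :=
  (Submodule.Quotient.mk_eq_zero _).2 (Submodule.mem_span_singleton_self _)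

/-- The restricted coproduct
`x̄₁ ⊗ ⋯ ⊗ xₙ ↦ ∑_{0 < j < n} (x̄₁ ⊗ ⋯ ⊗ xⱼ) ⨂ (x̄ⱼ₊₁ ⊗ ⋯ ⊗ xₙ)` on `𝓐(R) / 𝓐₀`, induced by
the coproduct of `𝓐(R)`: passing to the quotient kills the terms `j = 0` and `j = n`. -/
def redComul : S.RedA →ₗ[k] S.RedA ⊗[k] S.RedA :=
  S.unitLine.liftQ ((TensorProduct.map S.unitLine.mkQ S.unitLine.mkQ).comp S.comul) <|
    S.unitLine_le _ <| by
      have h : S.comul (S.tateIdeal.mkQ 1) = S.tateIdeal.mkQ 1 ⊗ₜ S.tateIdeal.mkQ 1 := by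
        rw [comul, Submodule.mkQ_apply, Submodule.liftQ_apply, LinearMap.comp_apply, decon_one]
        rfl
      rw [LinearMap.comp_apply, h, TensorProduct.map_tmul, mk_unit, TensorProduct.zero_tmul]

/-- The differential induced by `𝓓` on `𝓐(R) / 𝓐₀`. -/
def redD : S.RedA →ₗ[k] S.RedA :=
  S.unitLine.mapQ S.unitLine S.D <| by
    have h : S.D (S.tateIdeal.mkQ 1) = 0 := by
      rw [D, Submodule.mkQ_apply, Submodule.mapQ_apply, DGAlgebra.wordD_one]
      rfl
    have := S.unitLine_le (S.unitLine.mkQ.comp S.D) (by rw [LinearMap.comp_apply, h, map_zero])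
    rwa [LinearMap.ker_comp, Submodule.ker_mkQ] at this

/-- `a ↦ (-1) ^ |a| a` on `𝓐(R) / 𝓐₀`. -/
def redParity : S.RedA →ₗ[k] S.RedA :=
  S.unitLine.mapQ S.unitLine S.parityA <| by
    have h : S.parityA (S.tateIdeal.mkQ 1) = S.tateIdeal.mkQ 1 := by
      rw [parityA, Submodule.mkQ_apply, Submodule.mapQ_apply, wordParity_one]
    have := S.unitLine_le (S.unitLine.mkQ.comp S.parityA)
      (by rw [LinearMap.comp_apply, h, mk_unit])
    rwa [LinearMap.ker_comp, Submodule.ker_mkQ] at this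

/-- The class in `𝓐(R) / 𝓐₀` of an element of the tensor algebra. -/
def cls : TensorAlgebra k R →ₗ[k] S.RedA := S.unitLine.mkQ.comp S.tateIdeal.mkQ

theorem cls_surjective : Function.Surjective S.cls :=
  (Submodule.mkQ_surjective _).comp (Submodule.mkQ_surjective _)

theorem redComul_cls (w : TensorAlgebra k R) :
    S.redComul (S.cls w) = TensorProduct.map S.cls S.cls (decon w) := by
  rw [cls, TensorProduct.map_comp]; rfl

theorem redD_cls (w : TensorAlgebra k R) : S.redD (S.cls w) = S.cls (S.wordD w) := rfl

theorem redParity_cls (w : TensorAlgebra k R) :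
    S.redParity (S.cls w) = S.cls (wordParity 𝒜 w) := rfl

/-! ### The cobar complex -/

/-- The cobar construction of `𝓐(R)`: the tensor algebra of `𝓐(R) / 𝓐₀`, on which a bar word
`[a₁ | ⋯ | aₗ]` has degree `(|a₁| + 1) + ⋯ + (|aₗ| + 1)`. -/
abbrev Cobar : Type u := TensorAlgebra k S.RedA

/-- The cobar differential on generators:
`[a] ↦ -[𝓓 a] + ∑ (-1) ^ |a'| [a' | a'']`, where `∑ a' ⨂ a''` is the restricted coproduct. -/
def cobarGen : S.RedA →ₗ[k] S.Cobar :=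
  -(TensorAlgebra.ι k).comp S.redD +
    (LinearMap.mul' k S.Cobar).comp
      ((TensorProduct.map ((TensorAlgebra.ι k).comp S.redParity) (TensorAlgebra.ι k)).comp
        S.redComul)

/-- The cobar differential: the derivation (graded Leibniz rule, `[a]` having degree `|a| + 1`)
of the algebra `Cobar` extending `cobarGen`. -/
def cobarD : S.Cobar →ₗ[k] S.Cobar :=
  wordRec ((LinearMap.mul k S.Cobar).comp S.cobarGen)
    (-(LinearMap.mul k S.Cobar).comp ((TensorAlgebra.ι k).comp S.redParity)) 0

theorem cobarD_one : S.cobarD 1 = 0 := wordRec_one _ _ _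

theorem cobarD_cons (a : S.RedA) (c : S.Cobar) :
    S.cobarD (TensorAlgebra.ι k a * c) =
      S.cobarGen a * c - TensorAlgebra.ι k (S.redParity a) * S.cobarD c := by
  rw [cobarD, wordRec_cons, sub_eq_add_neg]; simp

theorem cobarD_ι (a : S.RedA) : S.cobarD (TensorAlgebra.ι k a) = S.cobarGen a := by
  have := S.cobarD_cons a 1
  simpa [cobarD_one] using this

/-- `c ↦ (-1) ^ (degree of c) c` on the cobar construction. -/
def cobarParity : S.Cobar →ₐ[k] S.Cobar :=
  TensorAlgebra.lift k (-(TensorAlgebra.ι k).comp S.redParity)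

theorem cobarParity_ι (a : S.RedA) :
    S.cobarParity (TensorAlgebra.ι k a) = -TensorAlgebra.ι k (S.redParity a) := by
  simp [cobarParity]

theorem cobarD_mul (x y : S.Cobar) :
    S.cobarD (x * y) = S.cobarD x * y + S.cobarParity x * S.cobarD y := by
  induction x using word_induction with
  | one => simp [cobarD_one]
  | add a b ha hb => simp only [add_mul, map_add, ha, hb]; abel
  | smul c a ha => simp [ha]
  | cons v w hw =>
    rw [mul_assoc, cobarD_cons, hw, cobarD_cons, map_mul, cobarParity_ι]
    noncomm_ring

/-- `u ⨂ v ↦ (-1) ^ |u| [u | v]`. -/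
def barPair : TensorAlgebra k R ⊗[k] TensorAlgebra k R →ₗ[k] S.Cobar :=
  (LinearMap.mul' k S.Cobar).comp
    (TensorProduct.map ((TensorAlgebra.ι k).comp (S.cls.comp (wordParity 𝒜)))
      ((TensorAlgebra.ι k).comp S.cls))

theorem barPair_tmul (u v : TensorAlgebra k R) :
    S.barPair (u ⊗ₜ v) = TensorAlgebra.ι k (S.cls (wordParity 𝒜 u)) *
      TensorAlgebra.ι k (S.cls v) := by simp [barPair]

theorem cobarGen_cls (w : TensorAlgebra k R) :
    S.cobarGen (S.cls w) = -TensorAlgebra.ι k (S.cls (S.wordD w)) + S.barPair (decon w) := by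
  have h : ∀ z, LinearMap.mul' k S.Cobar (TensorProduct.map
      ((TensorAlgebra.ι k).comp S.redParity) (TensorAlgebra.ι k)
      (TensorProduct.map S.cls S.cls z)) = S.barPair z := by
    intro z
    induction z with
    | zero => simp
    | add a b ha hb => simp only [map_add, ha, hb]
    | tmul a b => simp [barPair_tmul, redParity_cls]
  simp [cobarGen, redComul_cls, redD_cls, h]

theorem cobarParity_cobarGen (a : S.RedA) :
    S.cobarParity (S.cobarGen a) = S.cobarGen (S.redParity a) := by
  obtain ⟨w, rfl⟩ := S.cls_surjective a
  have h : ∀ z, S.cobarParity (S.barPair z) =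
      S.barPair (TensorProduct.map (wordParity 𝒜) (wordParity 𝒜) z) := by
    intro z
    induction z with
    | zero => simp
    | add a b ha hb => simp only [map_add, ha, hb]
    | tmul a b => simp [barPair_tmul, redParity_cls, cobarParity_ι]
  simp [redParity_cls, cobarGen_cls, cobarParity_ι, decon_wordParity, h,
    DGAlgebra.wordParity_wordD]

/-- `u ⨂ (v ⨂ w) ↦ (-1) ^ |v| [u | v | w]`. -/
def barTriple : TensorAlgebra k R ⊗[k] (TensorAlgebra k R ⊗[k] TensorAlgebra k R) →ₗ[k]
    S.Cobar :=
  (LinearMap.mul' k S.Cobar).comp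
    (TensorProduct.map ((TensorAlgebra.ι k).comp S.cls) S.barPair)

theorem cobarD_barPair (z : TensorAlgebra k R ⊗[k] TensorAlgebra k R) :
    S.cobarD (S.barPair z) =
      S.barPair (S.wordD.rTensor _ z) + S.barPair (TensorProduct.map (wordParity 𝒜) S.wordD z) +
      (S.barTriple (TensorProduct.assoc k _ _ _ (decon.rTensor (TensorAlgebra k R) z)) -
        S.barTriple (decon.lTensor (TensorAlgebra k R) z)) := by
  induction z with
  | zero => simp
  | add a b ha hb => simp only [map_add, ha, hb]; abel
  | tmul a b =>
    have h : ∀ z, S.barPair (TensorProduct.map (wordParity 𝒜) (wordParity 𝒜) z) *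
        TensorAlgebra.ι k (S.cls b) =
        S.barTriple (TensorProduct.assoc k _ _ _ (z ⊗ₜ b)) := by
      intro z
      induction z with
      | zero => simp
      | add a b ha hb => simp only [map_add, ha, hb, add_mul, TensorProduct.add_tmul]
      | tmul a b => simp [barPair_tmul, barTriple, wordParity_wordParity, mul_assoc]
    rw [barPair_tmul, cobarD_cons, cobarD_ι, cobarGen_cls, cobarGen_cls, decon_wordParity,
      redParity_cls, wordParity_wordParity, add_mul, h]
    simp only [LinearMap.rTensor_tmul, LinearMap.lTensor_tmul, TensorProduct.map_tmul,
      barPair_tmul, wordParity_wordParity, DGAlgebra.wordParity_wordD, barTriple,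
      LinearMap.comp_apply, LinearMap.mul'_apply, map_neg]
    noncomm_ring

theorem cobarD_cobarGen (a : S.RedA) : S.cobarD (S.cobarGen a) = 0 := by
  obtain ⟨w, rfl⟩ := S.cls_surjective a
  rw [cobarGen_cls, map_add, map_neg, cobarD_ι, cobarGen_cls, DGAlgebra.wordD_wordD,
    DGAlgebra.decon_wordD, cobarD_barPair, decon_coassoc]
  simp

theorem cobarD_cobarD (c : S.Cobar) : S.cobarD (S.cobarD c) = 0 := by
  induction c using word_induction with
  | one => simp [cobarD_one]
  | add a b ha hb => simp [ha, hb]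
  | smul c a ha => simp [ha]
  | cons v w hw =>
    rw [cobarD_cons, map_sub, cobarD_mul, cobarD_cobarGen, cobarD_cons, hw,
      cobarParity_cobarGen]
    simp

/-- `S.IsBarWord n i c`: `c = [a₁ | ⋯ | aₗ]` where each `aᵣ` is the class of a word
`x_{r1} ⊗ x_{r2} ⊗ ⋯` with homogeneous letters, the sum `n` of the weights of the `aᵣ` is the
weight of `c`, and the sum `i` of the `|aᵣ| + 1` is the cohomological degree of `c`. -/
inductive IsBarWord : ℕ → ℕ → S.Cobar → Prop
  | nil : IsBarWord 0 0 1
  | cons {m j n i : ℕ} {w : TensorAlgebra k R} {c : S.Cobar} (hw : IsWord 𝒜 m j w)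
      (hc : IsBarWord n i c) :
      IsBarWord (m + n) (j + 1 + i) (TensorAlgebra.ι k (S.cls w) * c)

/-- The part of weight `n` and cohomological degree `i` of the cobar construction. -/
def cobarPart (n i : ℕ) : Submodule k S.Cobar :=
  Submodule.span k {c | S.IsBarWord n i c}

variable {S} in
theorem IsBarWord.mem {n i : ℕ} {c : S.Cobar} (hc : S.IsBarWord n i c) :
    c ∈ S.cobarPart n i := Submodule.subset_span hc

variable {S} in
theorem cobarPart_congr {n n' i i' : ℕ} {c : S.Cobar} (hc : c ∈ S.cobarPart n i)
    (hn : n = n') (hi : i = i') : c ∈ S.cobarPart n' i' := by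
  subst hn hi; exact hc

theorem cobarPart_cons {m j n i : ℕ} {w : TensorAlgebra k R} {c : S.Cobar}
    (hw : w ∈ wordPart 𝒜 m j) (hc : c ∈ S.cobarPart n i) :
    TensorAlgebra.ι k (S.cls w) * c ∈ S.cobarPart (m + n) (j + 1 + i) := by
  induction hw using Submodule.span_induction with
  | mem w hw =>
    induction hc using Submodule.span_induction with
    | mem c hc => exact Submodule.subset_span (.cons hw hc)
    | zero => simp
    | add u v _ _ hu hv => rw [mul_add]; exact add_mem hu hv
    | smul r u _ hu => rw [mul_smul_comm]; exact Submodule.smul_mem _ _ hu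
  | zero => simp
  | add u v _ _ hu hv => simp only [map_add, add_mul]; exact add_mem hu hv
  | smul r u _ hu => simp only [map_smul, smul_mul_assoc]; exact Submodule.smul_mem _ _ hu

theorem cobarGen_mul_mem {m j n i : ℕ} {w : TensorAlgebra k R} {c : S.Cobar}
    (hw : IsWord 𝒜 m j w) (hc : c ∈ S.cobarPart n i) :
    S.cobarGen (S.cls w) * c ∈ S.cobarPart (m + n) (j + 1 + i + 1) := by
  rw [cobarGen_cls, add_mul, neg_mul]
  refine add_mem (neg_mem ?_) ?_
  · exact cobarPart_congr (S.cobarPart_cons (wordD_mem S.toDGAlgebra hw) hc) rfl (by omega)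
  · have h := decon_mem hw
    generalize decon w = z at h
    induction h using Submodule.span_induction with
    | mem z hz =>
      obtain ⟨n₁, j₁, n₂, j₂, u, v, hu, hv, rfl, rfl, rfl⟩ := hz
      rw [barPair_tmul, mul_assoc]
      exact cobarPart_congr (S.cobarPart_cons (wordParity_mem hu) (S.cobarPart_cons hv.mem hc))
        (by omega) (by omega)
    | zero => simp
    | add u v _ _ hu hv => rw [map_add, add_mul]; exact add_mem hu hv
    | smul r u _ hu => rw [map_smul, smul_mul_assoc]; exact Submodule.smul_mem _ _ hu

theorem cobarD_mem {n i : ℕ} {c : S.Cobar} (hc : c ∈ S.cobarPart n i) :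
    S.cobarD c ∈ S.cobarPart n (i + 1) := by
  induction hc using Submodule.span_induction with
  | mem c hc =>
    induction hc with
    | nil => rw [cobarD_one]; exact zero_mem _
    | @cons m j n i w c hw hc ih =>
      rw [cobarD_cons]
      exact sub_mem (S.cobarGen_mul_mem hw hc.mem)
        (cobarPart_congr (S.cobarPart_cons (wordParity_mem hw) ih) rfl (by omega))
  | zero => simp
  | add u v _ _ hu hv => rw [map_add]; exact add_mem hu hv
  | smul r u _ hu => rw [map_smul]; exact Submodule.smul_mem _ _ hu

/-- The weight `n` part of the cobar complex of `𝓐(R)`. -/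
def cobarComplex (n : ℕ) : CochainComplex (ModuleCat.{u} k) ℕ :=
  CochainComplex.of (fun i => ModuleCat.of k (S.cobarPart n i))
    (fun _ => ModuleCat.ofHom (S.cobarD.restrict fun _ hc => S.cobarD_mem hc))
    (fun _ =>
      ModuleCat.hom_ext (LinearMap.ext fun c => Subtype.ext (S.cobarD_cobarD c)))

/-! ### The Deligne complex -/

/-- The multiplication map `k(n) = k(1) ⊗ ⋯ ⊗ k(1) → R`. -/
def lineMul (n : ℕ) : (⨂[k]^n S.line) →ₗ[k] R :=
  PiTensorProduct.lift
    ((MultilinearMap.mkPiAlgebraFin k n R).compLinearMap fun _ => S.line.subtype)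

theorem list_prod_mem (l : List R) (h : ∀ t ∈ l, t ∈ S.line) :
    l.prod ∈ 𝒜 0 ∧ S.d l.prod = 0 := by
  have h1 : S.d 1 = 0 := by
    have := S.leibniz (SetLike.one_mem_graded 𝒜) 1
    simpa using this
  induction l with
  | nil => exact ⟨SetLike.one_mem_graded 𝒜, h1⟩
  | cons t l ih =>
    obtain ⟨ha, hb⟩ := ih fun s hs => h s (List.mem_cons_of_mem _ hs)
    have ht := h t List.mem_cons_self
    refine ⟨?_, ?_⟩
    · rw [List.prod_cons]; simpa using SetLike.mul_mem_graded (S.line_le ht) ha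
    · rw [List.prod_cons, S.leibniz (S.line_le ht), hb, S.d_line t ht]; simp

theorem lineMul_mem (n : ℕ) (z : ⨂[k]^n S.line) :
    S.lineMul n z ∈ 𝒜 0 ∧ S.d (S.lineMul n z) = 0 := by
  induction z using PiTensorProduct.induction_on with
  | smul_tprod r f =>
    have := S.list_prod_mem (List.ofFn fun i => (f i : R)) (by
      intro t ht
      obtain ⟨i, rfl⟩ := (List.mem_ofFn' _ _).1 ht
      exact (f i).2)
    simp only [map_smul, lineMul, PiTensorProduct.lift.tprod,
      MultilinearMap.compLinearMap_apply, MultilinearMap.mkPiAlgebraFin_apply,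
      Submodule.subtype_apply]
    exact ⟨Submodule.smul_mem _ _ this.1, by rw [this.2, smul_zero]⟩
  | add a b ha hb => simp only [map_add]; exact ⟨add_mem ha.1 hb.1, by rw [ha.2, hb.2, add_zero]⟩

/-- The space `R ^ p` if `p < n`, and `0` otherwise. -/
def deligneTerm (_S : TateDGAlgebra 𝒜) (n p : ℕ) : Submodule k R := if p < n then 𝒜 p else ⊥

/-- The multiplication `k(n) → R ^ 0` (zero if `n = 0`, when the target is zero). -/
def deligneAug (n : ℕ) : (⨂[k]^n S.line) →ₗ[k] S.deligneTerm n 0 :=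
  if h : 0 < n then
    (S.lineMul n).codRestrict _ fun z => by
      rw [deligneTerm, if_pos h]; exact (S.lineMul_mem n z).1
  else 0

/-- The differential `d : R ^ p → R ^ (p + 1)` if `p + 1 < n`, and zero otherwise. -/
def deligneD (n p : ℕ) : S.deligneTerm n p →ₗ[k] S.deligneTerm n (p + 1) :=
  if h : p + 1 < n then
    S.d.restrict fun x hx => by
      rw [deligneTerm, if_pos (Nat.lt_of_succ_lt h)] at hx
      rw [deligneTerm, if_pos h]
      exact S.d_mem hx
  else 0

theorem deligneD_deligneAug (n : ℕ) (z : ⨂[k]^n S.line) :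
    S.deligneD n 0 (S.deligneAug n z) = 0 := by
  by_cases h : 0 + 1 < n
  · have h' : 0 < n := by omega
    rw [deligneD, dif_pos h, deligneAug, dif_pos h']
    exact Subtype.ext (S.lineMul_mem n z).2
  · rw [deligneD, dif_neg h, LinearMap.zero_apply]

theorem deligneD_deligneD (n p : ℕ) (x : S.deligneTerm n p) :
    S.deligneD n (p + 1) (S.deligneD n p x) = 0 := by
  by_cases h : p + 1 + 1 < n
  · have h' : p + 1 < n := by omega
    rw [deligneD, dif_pos h, deligneD, dif_pos h']
    exact Subtype.ext (S.d_d _)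
  · rw [deligneD, dif_neg h, LinearMap.zero_apply]

/-- The objects of the weight `n` Deligne complex. -/
def deligneX (n : ℕ) : ℕ → ModuleCat.{u} k
  | 0 => ModuleCat.of k (⨂[k]^n S.line)
  | p + 1 => ModuleCat.of k (S.deligneTerm n p)

/-- The differentials of the weight `n` Deligne complex. -/
def deligneDiff (n : ℕ) : (i : ℕ) → (S.deligneX n i ⟶ S.deligneX n (i + 1))
  | 0 => ModuleCat.ofHom (S.deligneAug n)
  | p + 1 => ModuleCat.ofHom (S.deligneD n p)

/-- The weight `n` Deligne complex `k(n) → R⁰ → R¹ → ⋯ → R ^ (n - 1)`, with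
`k(n) = k(1) ⊗ ⋯ ⊗ k(1)` in degree `0` and `R ^ p`, for `p < n`, in degree `p + 1`. -/
def deligneComplex (n : ℕ) : CochainComplex (ModuleCat.{u} k) ℕ :=
  CochainComplex.of (S.deligneX n) (S.deligneDiff n) (fun i => by
    cases i with
    | zero => exact ModuleCat.hom_ext (LinearMap.ext (S.deligneD_deligneAug n))
    | succ p => exact ModuleCat.hom_ext (LinearMap.ext (S.deligneD_deligneD n p)))

end TateDGAlgebra

end TateDG

end

/-!
# The cobar complex of `𝓐(R)` computes the Deligne complex

Without its differential, `𝓐(R)` is the tensor coalgebra on the space of words `x̄ ⊗ t ⊗ ⋯ ⊗ t`,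
where `t` is a generator of the Tate line: a word whose first letter lies in a complement of
`k(1)` is cut, in a unique way, in front of each of its letters from that complement. The cobar
complex of a tensor coalgebra is quasi-isomorphic to the space of cogenerators, so in weight `n`
only the bar words `[x ⊗ t ⊗ ⋯ ⊗ t]` of length one should remain. As `𝓓` sends such a word to
`dx · t ⊗ t ⊗ ⋯ ⊗ t`, they form a subcomplex, and
`x ↦ (-1) ^ p [x t ^ (-q) ⊗ t ⊗ ⋯ ⊗ t]`, for `x` of degree `p` and `q = n - 1 - p` factors `t`,
maps the Deligne complex onto it for `n ≥ 1` (`cobarD_deligneBar`). The kernel is the acyclic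
complex formed by `k(n)` in degree `0` and its image in `R ^ 0` (`exists_of_deligneBar_eq_zero`,
`deligneAug_injective`). In weight `0` both complexes are `k` in degree `0`.

To contract the cobar complex onto this subcomplex in the presence of `d`, write a non-empty bar
word as `[x ⊗ w | c]`, a first letter `x` followed by a tail `w ⊗ c` in `T(R) ⊗ Cobar`. The
tails carry a differential `tailD`, for which
`D [x ⊗ w | c] = -[dx · w | c] + (-1) ^ |x| x · tailD (w ⊗ c)` (`cobarD_join`), and a homotopy
`tailHomotopy`, which removes the first bar when all the letters of `w` are `t`. Whatever `d` is,
this homotopy contracts the tails onto the span of the `t ⊗ ⋯ ⊗ t` exactly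
(`tailD_tailHomotopy_add`). Applied behind the first letter, it gives a homotopy of the cobar
complex which is a contraction up to terms in which the degree of the first letter has increased
(`join_sub_cobarD_homotopy`, `sub_homotopy_mem`). In weight `n` that degree is less than `n`, so
finitely many corrections suffice (`exists_add_cobarD_of_mem_headPart`).
-/

/-! ### Quasi-isomorphisms on elements -/

section ElementCriterion

open CategoryTheory

theorem LinearMap.exists_comp_eq_of_range_le {k V M N : Type*} [Field k] [AddCommGroup V]
    [Module k V] [AddCommGroup M] [Module k M] [AddCommGroup N] [Module k N] (f : M →ₗ[k] N)
    (g : V →ₗ[k] N) (h : LinearMap.range g ≤ LinearMap.range f) : ∃ l : V →ₗ[k] M, f ∘ₗ l = g := by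
  obtain ⟨l, hl⟩ := Module.projective_lifting_property f.rangeRestrict
    (g.codRestrict _ fun v => h ⟨v, rfl⟩) f.surjective_rangeRestrict
  exact ⟨l, LinearMap.ext fun v => congrArg Subtype.val (LinearMap.congr_fun hl v)⟩

/-- A morphism of complexes of vector spaces is a quasi-isomorphism in degree `j` if, on elements,
it is injective and surjective on cycles modulo boundaries. -/
theorem HomologicalComplex.quasiIsoAt_of_elements {k : Type u} [Field k] {ι : Type*}
    {c : ComplexShape ι} {K L : HomologicalComplex (ModuleCat.{u} k) c} (f : K ⟶ L) {i j l : ι}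
    (hi : c.prev j = i) (hl : c.next j = l)
    (hinj : ∀ x : K.X j, K.d j l x = 0 → ∀ y : L.X i, f.f j x = L.d i j y → ∃ z, x = K.d i j z)
    (hsurj : ∀ y : L.X j, L.d j l y = 0 →
      ∃ x : K.X j, K.d j l x = 0 ∧ ∃ z, y = f.f j x + L.d i j z) :
    QuasiIsoAt f j := by
  have hmono : Mono (homologyMap f j) := by
    rw [mono_homologyMap_iff_up_to_refinements f i j l hi hl]
    intro A x hx y hy
    obtain ⟨z, hz⟩ := LinearMap.exists_comp_eq_of_range_le (K.d i j).hom x.hom (by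
      rintro _ ⟨a, rfl⟩
      obtain ⟨z, hz⟩ := hinj (x a) (ConcreteCategory.congr_hom hx a) (y a)
        (ConcreteCategory.congr_hom hy a)
      exact ⟨z, hz.symm⟩)
    exact ⟨A, 𝟙 A, inferInstance, ModuleCat.ofHom z, ModuleCat.hom_ext (by simpa using hz.symm)⟩
  have hepi : Epi (homologyMap f j) := by
    rw [epi_homologyMap_iff_up_to_refinements f i j l hi hl]
    intro A y hy
    obtain ⟨z, hz⟩ := LinearMap.exists_comp_eq_of_range_le
      (((f.f j).hom ∘ₗ (LinearMap.ker (K.d j l).hom).subtype).coprod (L.d i j).hom) y.hom (by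
        rintro _ ⟨a, rfl⟩
        obtain ⟨x, hx, z, hz⟩ := hsurj (y a) (ConcreteCategory.congr_hom hy a)
        exact ⟨(⟨x, hx⟩, z), hz.symm⟩)
    refine ⟨A, 𝟙 A, inferInstance,
      ModuleCat.ofHom ((LinearMap.ker (K.d j l).hom).subtype ∘ₗ LinearMap.fst k _ _ ∘ₗ z), ?_,
      ModuleCat.ofHom (LinearMap.snd k _ _ ∘ₗ z), ?_⟩
    · exact ModuleCat.hom_ext (LinearMap.ext fun a => (z a).1.2)
    · refine ModuleCat.hom_ext (LinearMap.ext fun a => ?_)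
      simpa using (LinearMap.congr_fun hz a).symm
  rw [quasiIsoAt_iff_isIso_homologyMap]
  exact isIso_of_mono_of_epi _

end ElementCriterion

noncomputable section

namespace TateDG

open TensorAlgebra (ι)

variable {k R : Type u} [Field k] [Ring R] [Algebra k R] {𝒜 : ℕ → Submodule k R}
  [GradedAlgebra 𝒜]

/-! ### Trivialising the Tate line -/

namespace TateDGAlgebra

/-- A trivialisation of the Tate line `k(1)`: a generator `t` with its inverse in `R`, and a
linear functional `φ` on `R` which is normalised by `φ t = 1` and supported in degree `0`. The
functional amounts to a graded complement `ker φ` of `k(1)` in `R`. -/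
structure Trivialization (S : TateDGAlgebra 𝒜) where
  /-- the generator -/
  t : R
  /-- the inverse of the generator -/
  tinv : R
  /-- the functional -/
  φ : R →ₗ[k] k
  t_mem : t ∈ S.line
  t_mul_tinv : t * tinv = 1
  tinv_mem : tinv ∈ 𝒜 0
  φ_t : φ t = 1
  φ_of_mem : ∀ {i : ℕ} {x : R}, x ∈ 𝒜 (i + 1) → φ x = 0

theorem exists_trivialization (S : TateDGAlgebra 𝒜) : Nonempty S.Trivialization := by
  have hnt : Nontrivial S.line :=
    Module.nontrivial_of_finrank_pos (R := k) (by simp [S.finrank_line])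
  obtain ⟨⟨t, ht⟩, ht0⟩ := exists_ne (0 : S.line)
  have ht0 : t ≠ 0 := fun h => ht0 (Subtype.ext h)
  obtain ⟨s, hs⟩ := (S.isUnit_of_mem_line t ht ht0).exists_right_inv
  -- the degree `0` component of a right inverse of `t` is again one
  have hs0 : t * (DirectSum.decompose 𝒜 s 0 : R) = 1 := by
    have h := DirectSum.coe_decompose_mul_of_left_mem_zero 𝒜 (j := 0) (b := s) (S.line_le ht)
    rw [hs, DirectSum.decompose_of_mem_same _ (SetLike.one_mem_graded 𝒜)] at h
    exact h.symm
  have ⟨ψ, hψ⟩ : ∃ ψ : Module.Dual k R, ψ t ≠ 0 := by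
    by_contra! h
    exact ht0 ((Module.forall_dual_apply_eq_zero_iff k t).1 h)
  refine ⟨⟨t, DirectSum.decompose 𝒜 s 0, (ψ t)⁻¹ • ψ ∘ₗ GradedAlgebra.proj 𝒜 0, ht, hs0,
    SetLike.coe_mem _, ?_, fun {i x} hx => ?_⟩⟩
  · simp [DirectSum.decompose_of_mem_same _ (S.line_le ht), hψ]
  · simp [DirectSum.decompose_of_mem_ne 𝒜 hx (Nat.succ_ne_zero i)]

namespace Trivialization

variable {S : TateDGAlgebra 𝒜} (τ : S.Trivialization)

theorem t_ne_zero : τ.t ≠ 0 := fun h => by simpa [h] using τ.φ_t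

theorem commute_t (x : R) : Commute τ.t x := S.line_central τ.t τ.t_mem x

theorem d_t : S.d τ.t = 0 := S.d_line τ.t τ.t_mem

theorem t_mem_zero : τ.t ∈ 𝒜 0 := S.line_le τ.t_mem

theorem tinv_mul_t : τ.tinv * τ.t = 1 := by rw [← τ.commute_t, τ.t_mul_tinv]

theorem d_tinv : S.d τ.tinv = 0 := by
  have h1 : S.d 1 = 0 := by simpa using S.leibniz (SetLike.one_mem_graded 𝒜) 1
  have h := S.leibniz τ.t_mem_zero τ.tinv
  rw [τ.t_mul_tinv, h1, τ.d_t] at h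
  calc S.d τ.tinv = τ.tinv * (τ.t * S.d τ.tinv) := by rw [← mul_assoc, τ.tinv_mul_t, one_mul]
    _ = 0 := by simp [show τ.t * S.d τ.tinv = 0 by simpa using h.symm]

theorem exists_smul_t {s : R} (hs : s ∈ S.line) : ∃ c : k, s = c • τ.t := by
  obtain ⟨c, hc⟩ := (finrank_eq_one_iff_of_nonzero' (⟨τ.t, τ.t_mem⟩ : S.line)
    (fun h => τ.t_ne_zero (congrArg Subtype.val h))).1 S.finrank_line ⟨s, hs⟩
  exact ⟨c, (congrArg Subtype.val hc).symm⟩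

theorem φ_parity (x : R) : τ.φ (parity 𝒜 x) = τ.φ x := by
  induction x using graded_induction (𝒜 := 𝒜) with
  | add a b ha hb => simp [ha, hb]
  | zero => simp
  | homog i x hx =>
    rw [parity_of_mem hx, map_smul]
    cases i with
    | zero => simp
    | succ i => simp [τ.φ_of_mem hx]

theorem φ_d_mul (x y : R) : τ.φ (S.d x * y) = 0 := by
  induction x using graded_induction (𝒜 := 𝒜) with
  | add a b ha hb => simp [add_mul, ha, hb]
  | zero => simp
  | homog i x hx =>
    induction y using graded_induction (𝒜 := 𝒜) with
    | add a b ha hb => simp [mul_add, ha, hb]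
    | zero => simp
    | homog j y hy =>
      refine τ.φ_of_mem (i := i + j) ?_
      have := SetLike.mul_mem_graded (S.d_mem hx) hy
      rwa [add_right_comm] at this

/-- The projection of `R` onto `ker φ` along the Tate line. -/
def proj : R →ₗ[k] R := LinearMap.id - τ.φ.smulRight τ.t

theorem proj_apply (x : R) : τ.proj x = x - τ.φ x • τ.t := rfl

theorem proj_of_mem_line {s : R} (hs : s ∈ S.line) : τ.proj s = 0 := by
  obtain ⟨c, rfl⟩ := τ.exists_smul_t hs
  simp [proj_apply, τ.φ_t]

theorem proj_d_mul (x y : R) : τ.proj (S.d x * y) = S.d x * y := by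
  simp [proj_apply, φ_d_mul]

theorem d_proj (x : R) : S.d (τ.proj x) = S.d x := by simp [proj_apply, τ.d_t]

theorem parity_proj (x : R) : parity 𝒜 (τ.proj x) = τ.proj (parity 𝒜 x) := by
  simp [proj_apply, φ_parity, S.parity_line τ.t_mem]

theorem proj_mem {i : ℕ} {x : R} (hx : x ∈ 𝒜 i) : τ.proj x ∈ 𝒜 i := by
  rw [proj_apply]
  cases i with
  | zero => exact sub_mem hx (Submodule.smul_mem _ _ τ.t_mem_zero)
  | succ i => simpa [τ.φ_of_mem hx] using hx

end Trivialization

/-! ### Bar words as a first letter followed by a tail -/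

section Tail

variable (S : TateDGAlgebra 𝒜)

theorem cls_one : S.cls 1 = 0 := S.mk_unit

theorem cls_cons_of_mem_line {s : R} (hs : s ∈ S.line) (w : TensorAlgebra k R) :
    S.cls (ι k s * w) = 0 := by
  rw [cls, LinearMap.comp_apply, Submodule.mkQ_apply S.tateIdeal,
    (Submodule.Quotient.mk_eq_zero S.tateIdeal).2 (S.cons_mem_tateIdeal hs w), map_zero]

variable {S} in
/-- Descent of a linear map from `T(R)` to `𝓐(R) / 𝓐₀`. -/
def clsLift {M : Type*} [AddCommGroup M] [Module k M] (f : TensorAlgebra k R →ₗ[k] M)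
    (h1 : f 1 = 0) (ht : ∀ s ∈ S.line, ∀ w, f (ι k s * w) = 0) : S.RedA →ₗ[k] M :=
  S.unitLine.liftQ (S.tateIdeal.liftQ f (S.tateIdeal_le f ht)) (S.unitLine_le _ h1)

theorem clsLift_cls {M : Type*} [AddCommGroup M] [Module k M] (f : TensorAlgebra k R →ₗ[k] M)
    (h1 : f 1 = 0) (ht : ∀ s ∈ S.line, ∀ w, f (ι k s * w) = 0) (w : TensorAlgebra k R) :
    clsLift f h1 ht (S.cls w) = f w := rfl

/-- The space `T(R) ⊗ Cobar` of tails: `w ⊗ c` is what follows the first letter `x` in the bar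
word `[x ⊗ w | c]`. -/
abbrev Tail : Type u := TensorAlgebra k R ⊗[k] S.Cobar

/-- Prepending of a letter to a tail: `x · (w ⊗ c) = (x ⊗ w) ⊗ c`. -/
def tailCons : R →ₗ[k] S.Tail →ₗ[k] S.Tail :=
  (LinearMap.rTensorHom S.Cobar).comp ((LinearMap.mul k (TensorAlgebra k R)).comp (ι k))

@[simp]
theorem tailCons_tmul (x : R) (w : TensorAlgebra k R) (c : S.Cobar) :
    S.tailCons x (w ⊗ₜ c) = (ι k x * w) ⊗ₜ c := rfl

/-- The concatenation `w ⊗ c ↦ [w | c]`. -/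
def bar : S.Tail →ₗ[k] S.Cobar :=
  TensorProduct.lift ((LinearMap.mul k S.Cobar).comp ((ι k).comp S.cls))

/-- The bar word `[x ⊗ w | c]` with first letter `x` and tail `w ⊗ c`. -/
def join : R →ₗ[k] S.Tail →ₗ[k] S.Cobar := (LinearMap.llcomp k _ _ _ S.bar).comp S.tailCons

@[simp]
theorem join_tmul (x : R) (w : TensorAlgebra k R) (c : S.Cobar) :
    S.join x (w ⊗ₜ c) = ι k (S.cls (ι k x * w)) * c := rfl

/-- The bar word `[y · w | c]`, where `y` multiplies the first letter of `w`. -/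
def joinMul : R →ₗ[k] S.Tail →ₗ[k] S.Cobar :=
  (LinearMap.llcomp k _ _ _ S.bar).comp ((LinearMap.rTensorHom S.Cobar).comp leftMul.flip)

@[simp]
theorem joinMul_tmul (y : R) (w : TensorAlgebra k R) (c : S.Cobar) :
    S.joinMul y (w ⊗ₜ c) = ι k (S.cls (leftMul w y)) * c := rfl

theorem join_of_mem_line {s : R} (hs : s ∈ S.line) (m : S.Tail) : S.join s m = 0 := by
  induction m using TensorProduct.induction_on with
  | zero => simp
  | add a b ha hb => simp [ha, hb]
  | tmul w c => simp [S.cls_cons_of_mem_line hs]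

/-- `(u ⊗ v) ⊗ c ↦ (-1) ^ |u| u ⊗ [v | c]`. -/
def tailPair (c : S.Cobar) : TensorAlgebra k R ⊗[k] TensorAlgebra k R →ₗ[k] S.Tail :=
  TensorProduct.map (wordParity 𝒜) (((LinearMap.mul k S.Cobar).flip c).comp ((ι k).comp S.cls))

@[simp]
theorem tailPair_tmul (c : S.Cobar) (u v : TensorAlgebra k R) :
    S.tailPair c (u ⊗ₜ v) = wordParity 𝒜 u ⊗ₜ (ι k (S.cls v) * c) := rfl

/-- The differential on tails:
`∂ (w ⊗ c) = -𝓓 w ⊗ c + ∑ (-1) ^ |w'| w' ⊗ [w'' | c] - (-1) ^ |w| w ⊗ D c`,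
where `∑ w' ⊗ w''` is the deconcatenation of `w`. -/
def tailD : S.Tail →ₗ[k] S.Tail :=
  TensorProduct.lift <| LinearMap.mk₂ k
    (fun w c => -S.wordD w ⊗ₜ c + S.tailPair c (decon w) - wordParity 𝒜 w ⊗ₜ S.cobarD c)
    (by intros; simp only [map_add, TensorProduct.add_tmul, neg_add]; abel)
    (by intros; simp only [map_smul, TensorProduct.smul_tmul', smul_sub, smul_add, smul_neg])
    (by
      intro w c c'
      have h : S.tailPair (c + c') = S.tailPair c + S.tailPair c' := by
        ext; simp [mul_add, TensorProduct.tmul_add]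
      simp only [h, map_add, TensorProduct.tmul_add, LinearMap.add_apply]; abel)
    (by
      intro r w c
      have h : S.tailPair (r • c) = r • S.tailPair c := by ext; simp
      simp only [h, map_smul, TensorProduct.tmul_smul, LinearMap.smul_apply, smul_sub, smul_add,
        smul_neg])

theorem tailD_tmul (w : TensorAlgebra k R) (c : S.Cobar) :
    S.tailD (w ⊗ₜ c) =
      -S.wordD w ⊗ₜ c + S.tailPair c (decon w) - wordParity 𝒜 w ⊗ₜ S.cobarD c := rfl

theorem tailD_one (c : S.Cobar) : S.tailD (1 ⊗ₜ c) = -(1 : TensorAlgebra k R) ⊗ₜ S.cobarD c := by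
  simp [tailD_tmul, DGAlgebra.wordD_one, decon_one, wordParity_one, cls_one]

theorem tailD_cons (y : R) (w : TensorAlgebra k R) (c : S.Cobar) :
    S.tailD ((ι k y * w) ⊗ₜ c) = -(leftMul w (S.d y) ⊗ₜ c) + 1 ⊗ₜ S.join y (w ⊗ₜ c) +
      S.tailCons (parity 𝒜 y) (S.tailD (w ⊗ₜ c)) := by
  have h : ∀ z, S.tailPair c ((LinearMap.mulLeft k (ι k y)).rTensor (TensorAlgebra k R) z) =
      S.tailCons (parity 𝒜 y) (S.tailPair c z) := by
    intro z
    induction z with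
    | zero => simp
    | add a b ha hb => simp only [map_add, ha, hb]
    | tmul a b => simp [wordParity_cons]
  simp only [tailD_tmul, DGAlgebra.wordD_cons, decon_cons, map_add, map_sub, h,
    wordParity_cons, tailPair_tmul, wordParity_one, tailCons_tmul, join_tmul,
    TensorProduct.add_tmul, map_neg]
  abel

theorem cobarD_join (x : R) (m : S.Tail) :
    S.cobarD (S.join x m) = -S.joinMul (S.d x) m + S.join (parity 𝒜 x) (S.tailD m) := by
  induction m using TensorProduct.induction_on with
  | zero => simp
  | add a b ha hb => simp only [map_add, ha, hb]; abel
  | tmul w c =>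
    have h : ∀ z, S.barPair ((LinearMap.mulLeft k (ι k x)).rTensor (TensorAlgebra k R) z) * c =
        S.join (parity 𝒜 x) (S.tailPair c z) := by
      intro z
      induction z with
      | zero => simp
      | add a b ha hb => simp only [map_add, add_mul, ha, hb]
      | tmul a b => simp [barPair_tmul, wordParity_cons, mul_assoc]
    simp only [join_tmul, cobarD_cons, cobarGen_cls, redParity_cls, DGAlgebra.wordD_cons,
      decon_cons, map_add, map_sub, add_mul, h, tailD_tmul, barPair_tmul, wordParity_one, cls_one,
      wordParity_cons, joinMul_tmul, map_neg, neg_mul, zero_mul, map_zero]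
    noncomm_ring

end Tail

namespace Trivialization

variable {S : TateDGAlgebra 𝒜} (τ : S.Trivialization)

/-! ### The contraction of the tails -/

/-- The projection `x₁ ⊗ ⋯ ⊗ xₘ ↦ φ x₁ ⋯ φ xₘ · t ⊗ ⋯ ⊗ t` of `T(R)` onto the tensor algebra of the
Tate line. -/
def lineWord : TensorAlgebra k R →ₐ[k] TensorAlgebra k R :=
  TensorAlgebra.lift k (τ.φ.smulRight (ι k τ.t))

theorem lineWord_cons (x : R) (w : TensorAlgebra k R) :
    τ.lineWord (ι k x * w) = τ.φ x • (ι k τ.t * τ.lineWord w) := by simp [lineWord]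

theorem lineWord_leftMul_d (x : R) (w : TensorAlgebra k R) :
    τ.lineWord (leftMul w (S.d x)) = 0 := by
  induction w using word_induction with
  | one => simp [leftMul_one]
  | add a b ha hb => simp [ha, hb]
  | smul c a ha => simp [ha]
  | cons v w hw => simp [leftMul_cons, lineWord_cons, φ_d_mul]

/-- The section `x̄₁ ⊗ x₂ ⊗ ⋯ ↦ proj x₁ ⊗ x₂ ⊗ ⋯` of `T(R) → 𝓐(R) / 𝓐₀`. -/
def lift : S.RedA →ₗ[k] TensorAlgebra k R :=
  clsLift
    (wordRec ((LinearMap.mul k (TensorAlgebra k R)).comp ((ι k).comp τ.proj)) 0 0)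
    (wordRec_one _ _ _)
    (fun s hs w => by simp [wordRec_cons, τ.proj_of_mem_line hs])

theorem lift_cls_one : τ.lift (S.cls 1) = 0 := wordRec_one _ _ _

theorem lift_cls_cons (x : R) (w : TensorAlgebra k R) :
    τ.lift (S.cls (ι k x * w)) = ι k (τ.proj x) * w := by
  simp [lift, clsLift_cls, wordRec_cons]

theorem lift_cls_leftMul_d (x : R) (w : TensorAlgebra k R) :
    τ.lift (S.cls (leftMul w (S.d x))) = leftMul w (S.d x) := by
  induction w using word_induction with
  | one => simp [leftMul_one]
  | add a b ha hb => simp [ha, hb]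
  | smul c a ha => simp [ha]
  | cons v w hw => simp [leftMul_cons, lift_cls_cons, proj_d_mul]

/-- Removal of the first bar: `[a | c] ↦ lift a ⊗ c`, and `1 ↦ 0`. -/
def unbar : S.Cobar →ₗ[k] S.Tail :=
  wordRec ((TensorProduct.mk k (TensorAlgebra k R) S.Cobar).comp τ.lift) 0 0

theorem unbar_one : τ.unbar 1 = 0 := wordRec_one _ _ _

theorem unbar_cons (a : S.RedA) (c : S.Cobar) : τ.unbar (ι k a * c) = τ.lift a ⊗ₜ c := by
  simp [unbar, wordRec_cons]

theorem unbar_join (x : R) (m : S.Tail) :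
    τ.unbar (S.join x m) = S.tailCons (τ.proj x) m := by
  induction m using TensorProduct.induction_on with
  | zero => simp
  | add a b ha hb => simp only [map_add, ha, hb]
  | tmul w c => simp [unbar_cons, lift_cls_cons]

/-- Left multiplication by `T(R)` on tails. -/
def tailMul (S : TateDGAlgebra 𝒜) : TensorAlgebra k R →ₗ[k] S.Tail →ₗ[k] S.Tail :=
  (LinearMap.rTensorHom S.Cobar).comp (LinearMap.mul k (TensorAlgebra k R))

@[simp]
theorem tailMul_tmul (v w : TensorAlgebra k R) (c : S.Cobar) :
    tailMul S v (w ⊗ₜ c) = (v * w) ⊗ₜ c := rfl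

theorem tailMul_one (m : S.Tail) : tailMul S 1 m = m := by
  induction m using TensorProduct.induction_on with
  | zero => simp
  | add a b ha hb => simp only [map_add, ha, hb]
  | tmul u c => simp

theorem tailMul_cons (x : R) (w : TensorAlgebra k R) (m : S.Tail) :
    tailMul S (ι k x * w) m = S.tailCons x (tailMul S w m) := by
  induction m using TensorProduct.induction_on with
  | zero => simp
  | add a b ha hb => simp only [map_add, ha, hb]
  | tmul u c => simp [mul_assoc]

/-- The contracting homotopy on tails: it removes the first bar of a tail whose letters before
that bar lie in the Tate line, and kills a tail that has, before the first bar, a letter in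
`ker φ`. -/
def tailHomotopy : S.Tail →ₗ[k] S.Tail :=
  TensorProduct.lift <|
    (LinearMap.lcomp k S.Tail τ.unbar).comp ((tailMul S).comp τ.lineWord.toLinearMap)

theorem tailHomotopy_tmul (w : TensorAlgebra k R) (c : S.Cobar) :
    τ.tailHomotopy (w ⊗ₜ c) =
      tailMul S (τ.lineWord w) (τ.unbar c) := rfl

theorem tailHomotopy_one (c : S.Cobar) : τ.tailHomotopy (1 ⊗ₜ c) = τ.unbar c := by
  simp [tailHomotopy_tmul, tailMul_one]

theorem tailHomotopy_tailCons (x : R) (m : S.Tail) :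
    τ.tailHomotopy (S.tailCons x m) = τ.φ x • S.tailCons τ.t (τ.tailHomotopy m) := by
  induction m using TensorProduct.induction_on with
  | zero => simp
  | add a b ha hb => simp only [map_add, ha, hb, smul_add]
  | tmul w c =>
    rw [tailCons_tmul, tailHomotopy_tmul, tailHomotopy_tmul, lineWord_cons, map_smul,
      LinearMap.smul_apply, tailMul_cons]

theorem tailHomotopy_leftMul_d (x : R) (w : TensorAlgebra k R) (c : S.Cobar) :
    τ.tailHomotopy (leftMul w (S.d x) ⊗ₜ c) = 0 := by
  simp [tailHomotopy_tmul, lineWord_leftMul_d]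

theorem tailD_tailCons_t (m : S.Tail) :
    S.tailD (S.tailCons τ.t m) = S.tailCons τ.t (S.tailD m) := by
  induction m using TensorProduct.induction_on with
  | zero => simp
  | add a b ha hb => simp only [map_add, ha, hb]
  | tmul w c =>
    simp [tailD_cons, τ.d_t, S.cls_cons_of_mem_line τ.t_mem, S.parity_line τ.t_mem]

/-- The differential on tails commutes with left multiplication by the tensor algebra of the Tate
line, because `t` is a cycle of degree `0` which vanishes at the beginning of a bar. -/
theorem tailD_lineWord (w : TensorAlgebra k R) (m : S.Tail) :
    S.tailD (tailMul S (τ.lineWord w) m) =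
      tailMul S (τ.lineWord w) (S.tailD m) := by
  induction w using word_induction generalizing m with
  | one => simp [tailMul_one]
  | add a b ha hb => simp only [map_add, LinearMap.add_apply, ha, hb]
  | smul c a ha => simp only [map_smul, LinearMap.smul_apply, ha]
  | cons v w hw =>
    simp only [lineWord_cons, map_smul, LinearMap.smul_apply, tailMul_cons, tailD_tailCons_t, hw]

/-- The part of `∂ h + h ∂ = 1 - p` that only involves the letters before the first bar; the sum
over the deconcatenations telescopes. -/
theorem tailHomotopy_tailD (w : TensorAlgebra k R) (c : S.Cobar) :
    τ.tailHomotopy (S.tailD (w ⊗ₜ c)) = (w - τ.lineWord w) ⊗ₜ c -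
      tailMul S (τ.lineWord w) (τ.unbar (S.cobarD c)) := by
  induction w using word_induction with
  | one => simp [tailD_one, tailHomotopy_one, tailMul_one]
  | add a b ha hb =>
    simp only [TensorProduct.add_tmul, map_add, ha, hb, LinearMap.add_apply,
      TensorProduct.sub_tmul]
    abel
  | smul r a ha =>
    simp only [← TensorProduct.smul_tmul', map_smul, ha, LinearMap.smul_apply, ← smul_sub]
    exact smul_sub r _ _
  | cons y w hw =>
    rw [tailD_cons, map_add, map_add, map_neg, tailHomotopy_leftMul_d, tailHomotopy_one,
      unbar_join, tailHomotopy_tailCons, hw, φ_parity]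
    simp only [proj_apply, lineWord_cons, map_sub, map_smul, LinearMap.sub_apply,
      LinearMap.smul_apply, tailMul_cons, tailCons_tmul, TensorProduct.sub_tmul, smul_sub,
      TensorProduct.smul_tmul']
    abel

/-- The part of `∂ h + h ∂ = 1 - p` that involves the first bar: `∂ (unbar [a | c])` contains every
term of `unbar (D [a | c])`, and in addition the term `1 ⊗ [a | c]`, which puts the bar back. -/
theorem tailD_unbar (c : S.Cobar) :
    S.tailD (τ.unbar c) - τ.unbar (S.cobarD c) =
      1 ⊗ₜ c - TensorAlgebra.algebraMapInv c • 1 ⊗ₜ 1 := by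
  induction c using word_induction with
  | one => simp [unbar_one, cobarD_one]
  | add a b ha hb =>
    simp only [map_add, TensorProduct.tmul_add, add_smul, add_sub_add_comm, ha, hb]
  | smul r a ha =>
    simpa only [map_smul, TensorProduct.tmul_smul, smul_eq_mul, mul_smul, smul_sub]
      using congrArg (r • ·) ha
  | cons a c hc =>
    obtain ⟨v, rfl⟩ := S.cls_surjective a
    clear hc
    induction v using word_induction with
    | one => simp [cls_one]
    | add a b ha hb =>
      simp only [map_add, TensorProduct.tmul_add, add_mul, add_smul, add_sub_add_comm, ha, hb]
    | smul r a ha =>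
      simpa only [map_smul, TensorProduct.tmul_smul, smul_eq_mul, mul_smul, smul_mul_assoc,
        smul_sub] using congrArg (r • ·) ha
    | cons y w hw =>
      have h : τ.unbar (S.joinMul (S.d y) (w ⊗ₜ c)) = leftMul w (S.d y) ⊗ₜ c := by
        rw [joinMul_tmul, unbar_cons, lift_cls_leftMul_d]
      have h' : S.join (τ.proj y) (w ⊗ₜ c) = S.join y (w ⊗ₜ c) := by
        rw [proj_apply, map_sub, map_smul, LinearMap.sub_apply, LinearMap.smul_apply,
          S.join_of_mem_line τ.t_mem, smul_zero, sub_zero]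
      rw [← join_tmul, unbar_join, tailCons_tmul, tailD_cons, cobarD_join, map_add, map_neg, h,
        h', unbar_join, d_proj, parity_proj]
      have hε : TensorAlgebra.algebraMapInv (ι k (S.cls (ι k y * w)) * c) = 0 := by
        simp [TensorAlgebra.algebraMapInv]
      rw [join_tmul, hε]
      simp

/-- The projection of the tails onto the tensor algebra of the Tate line. -/
def tailProj : S.Tail →ₗ[k] S.Tail :=
  TensorProduct.map τ.lineWord.toLinearMap
    ((Algebra.linearMap k S.Cobar).comp TensorAlgebra.algebraMapInv.toLinearMap)

theorem tailProj_tmul (w : TensorAlgebra k R) (c : S.Cobar) :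
    τ.tailProj (w ⊗ₜ c) = TensorAlgebra.algebraMapInv c • τ.lineWord w ⊗ₜ 1 := by
  simp [tailProj, Algebra.algebraMap_eq_smul_one]

theorem tailD_tailHomotopy_add (m : S.Tail) :
    S.tailD (τ.tailHomotopy m) + τ.tailHomotopy (S.tailD m) = m - τ.tailProj m := by
  induction m using TensorProduct.induction_on with
  | zero => simp
  | add a b ha hb => simp only [map_add, add_sub_add_comm, ← ha, ← hb]; abel
  | tmul w c =>
    have h := congrArg (tailMul S (τ.lineWord w)) (τ.tailD_unbar c)
    rw [tailHomotopy_tailD, tailHomotopy_tmul, tailD_lineWord, tailProj_tmul]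
    simp only [map_sub, map_smul, tailMul_tmul, mul_one] at h
    rw [TensorProduct.sub_tmul, eq_add_of_sub_eq h]
    abel

/-! ### The homotopy on the cobar complex -/

/-- The homotopy on the cobar complex: `tailHomotopy` on the tail after the first letter `x`, with
sign `(-1) ^ |x|`. -/
def homotopy : S.Cobar →ₗ[k] S.Cobar :=
  wordRec
    (clsLift
      (wordRec
        (LinearMap.mk₂ k
          (fun x w => (S.join (parity 𝒜 x) ∘ₗ τ.tailHomotopy) ∘ₗ TensorProduct.mk k _ _ w)
          (by intros; ext; simp)
          (by intros; ext; simp)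
          (by intros; ext; simp)
          (by intros; ext; simp)) 0 0)
      (wordRec_one _ _ _)
      (fun s hs w => by
        ext; simp [wordRec_cons, S.parity_line hs, S.join_of_mem_line hs]))
    0 0

theorem homotopy_join (x : R) (m : S.Tail) :
    τ.homotopy (S.join x m) = S.join (parity 𝒜 x) (τ.tailHomotopy m) := by
  induction m using TensorProduct.induction_on with
  | zero => simp
  | add a b ha hb => simp only [map_add, ha, hb]
  | tmul w c => simp [homotopy, clsLift_cls, wordRec_cons]

/-- The homotopy formula: up to the terms that raise the degree of the first letter, the
commutator of the homotopy and the differential is the identity minus the projection. -/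
theorem join_sub_cobarD_homotopy (x : R) (m : S.Tail) :
    S.join x m - S.cobarD (τ.homotopy (S.join x m)) - τ.homotopy (S.cobarD (S.join x m)) =
      S.join x (τ.tailProj m) + S.joinMul (S.d (parity 𝒜 x)) (τ.tailHomotopy m) +
        τ.homotopy (S.joinMul (S.d x) m) := by
  have h := congrArg (S.join x) (τ.tailD_tailHomotopy_add m)
  rw [map_add, map_sub] at h
  rw [homotopy_join, cobarD_join, cobarD_join, parity_parity, map_add, map_neg, homotopy_join,
    parity_parity, eq_sub_of_add_eq h]
  abel

end Trivialization

/-! ### Weights and degrees of tails -/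

section TailPart

variable (S : TateDGAlgebra 𝒜)

/-- The part of weight `n` and degree `j` of the space of tails. -/
def tailPart (n j : ℕ) : Submodule k S.Tail :=
  Submodule.span k {z | ∃ n₁ j₁ n₂ j₂ w c, IsWord 𝒜 n₁ j₁ w ∧ S.IsBarWord n₂ j₂ c ∧
    n₁ + n₂ = n ∧ j₁ + j₂ = j ∧ w ⊗ₜ[k] c = z}

/-- The part of weight `n` and degree `i` of the cobar complex spanned by the non-empty bar words
whose first letter has degree at least `a`. -/
def headPart (a n i : ℕ) : Submodule k S.Cobar :=
  Submodule.span k {z | ∃ b m j, ∃ x ∈ 𝒜 b, ∃ y ∈ S.tailPart m j, a ≤ b ∧ 1 + b + m = n ∧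
    b + 1 + j = i ∧ S.join x y = z}

variable {S}

theorem tmul_mem_tailPart {n₁ j₁ n₂ j₂ n j : ℕ} {w : TensorAlgebra k R} {c : S.Cobar}
    (hw : IsWord 𝒜 n₁ j₁ w) (hc : S.IsBarWord n₂ j₂ c) (hn : n₁ + n₂ = n) (hj : j₁ + j₂ = j) :
    w ⊗ₜ c ∈ S.tailPart n j :=
  Submodule.subset_span ⟨n₁, j₁, n₂, j₂, w, c, hw, hc, hn, hj, rfl⟩

theorem tailCons_mem {a n j n' j' : ℕ} {x : R} {m : S.Tail} (hx : x ∈ 𝒜 a)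
    (hm : m ∈ S.tailPart n j) (hn : 1 + a + n = n') (hj : a + j = j') :
    S.tailCons x m ∈ S.tailPart n' j' := by
  induction hm using Submodule.span_induction with
  | mem z hz =>
    obtain ⟨n₁, j₁, n₂, j₂, w, c, hw, hc, rfl, rfl, rfl⟩ := hz
    exact tmul_mem_tailPart (.cons hx hw) hc (by omega) (by omega)
  | zero => simp
  | add u v _ _ hu hv => rw [map_add]; exact add_mem hu hv
  | smul r u _ hu => rw [map_smul]; exact Submodule.smul_mem _ _ hu

theorem join_mem_headPart {a b m j n i : ℕ} {x : R} {y : S.Tail} (hx : x ∈ 𝒜 b)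
    (hy : y ∈ S.tailPart m j) (ha : a ≤ b) (hn : 1 + b + m = n) (hi : b + 1 + j = i) :
    S.join x y ∈ S.headPart a n i :=
  Submodule.subset_span ⟨b, m, j, x, hx, y, hy, ha, hn, hi, rfl⟩

theorem joinMul_mem_headPart {b m j n i : ℕ} {x : R} {y : S.Tail} (hx : x ∈ 𝒜 b)
    (hy : y ∈ S.tailPart m j) (hn : b + m = n) (hi : b + 1 + j = i) :
    S.joinMul x y ∈ S.headPart b n i := by
  induction hy using Submodule.span_induction with
  | mem z hz =>
    obtain ⟨n₁, j₁, n₂, j₂, w, c, hw, hc, rfl, rfl, rfl⟩ := hz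
    rw [joinMul_tmul]
    cases hw with
    | nil => simp [leftMul_one]
    | cons hv hw =>
      rw [leftMul_cons, ← join_tmul]
      exact join_mem_headPart (SetLike.mul_mem_graded hx hv) (tmul_mem_tailPart hw hc rfl rfl)
        (by omega) (by omega) (by omega)
  | zero => simp
  | add u v _ _ hu hv => rw [map_add]; exact add_mem hu hv
  | smul r u _ hu => rw [map_smul]; exact Submodule.smul_mem _ _ hu

theorem headPart_le_cobarPart (a n i : ℕ) : S.headPart a n i ≤ S.cobarPart n i := by
  refine Submodule.span_le.2 ?_
  rintro _ ⟨b, m, j, x, hx, y, hy, -, rfl, rfl, rfl⟩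
  change S.join x y ∈ _
  induction hy using Submodule.span_induction with
  | mem z hz =>
    obtain ⟨n₁, j₁, n₂, j₂, w, c, hw, hc, rfl, rfl, rfl⟩ := hz
    exact S.cobarPart_congr (IsBarWord.cons (.cons hx hw) hc).mem (by omega) (by omega)
  | zero => simp
  | add u v _ _ hu hv => rw [map_add]; exact add_mem hu hv
  | smul r u _ hu => rw [map_smul]; exact Submodule.smul_mem _ _ hu

theorem IsBarWord.mem_headPart {n i : ℕ} {c : S.Cobar} (hc : S.IsBarWord n i c) (hn : n ≠ 0) :
    c ∈ S.headPart 0 n i := by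
  cases hc with
  | nil => exact absurd rfl hn
  | cons hw hc =>
    cases hw with
    -- the empty word is allowed inside a bar, where it is zero
    | nil => simp [cls_one]
    | cons hx hw =>
      rw [← join_tmul]
      exact join_mem_headPart hx (tmul_mem_tailPart hw hc rfl rfl) (by omega) (by omega)
        (by omega)

theorem cobarPart_le_headPart {n : ℕ} (hn : n ≠ 0) (i : ℕ) :
    S.cobarPart n i ≤ S.headPart 0 n i :=
  Submodule.span_le.2 fun _ hc => hc.mem_headPart hn

theorem headPart_eq_bot_of_le {a n : ℕ} (h : n ≤ a) (i : ℕ) : S.headPart a n i = ⊥ := by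
  rw [headPart, Submodule.span_eq_bot]
  rintro _ ⟨b, m, j, x, hx, y, hy, hab, hn, -, -⟩
  omega

theorem headPart_degree_zero (a n : ℕ) : S.headPart a n 0 = ⊥ := by
  rw [headPart, Submodule.span_eq_bot]
  rintro _ ⟨b, m, j, x, hx, y, hy, -, -, hi, -⟩
  omega

end TailPart

theorem parity_mem {i : ℕ} {x : R} (hx : x ∈ 𝒜 i) : parity 𝒜 x ∈ 𝒜 i := by
  rw [parity_of_mem hx]; exact Submodule.smul_mem _ _ hx

namespace Trivialization

variable {S : TateDGAlgebra 𝒜} (τ : S.Trivialization)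

theorem lineWord_of_isWord {n j : ℕ} {w : TensorAlgebra k R} (hw : IsWord 𝒜 n j w) :
    ∃ r : k, τ.lineWord w = r • ι k τ.t ^ n ∧ (j ≠ 0 → r = 0) := by
  induction hw with
  | nil => exact ⟨1, by simp, by simp⟩
  | @cons a n j x w hx hw ih =>
    obtain ⟨r, hr, hj⟩ := ih
    cases a with
    | zero =>
      refine ⟨τ.φ x * r, ?_, fun h => by simp [hj (by omega)]⟩
      rw [lineWord_cons, hr, add_zero, add_comm, pow_succ', mul_smul, mul_smul_comm]
    | succ a => exact ⟨0, by simp [lineWord_cons, τ.φ_of_mem hx], fun _ => rfl⟩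

theorem unbar_of_isBarWord {n i : ℕ} {c : S.Cobar} (hc : S.IsBarWord n i c) :
    (i = 0 → τ.unbar c = 0) ∧ ∀ i', i = i' + 1 → τ.unbar c ∈ S.tailPart n i' := by
  cases hc with
  | nil => simp [unbar_one]
  | cons hw hc =>
    refine ⟨fun h => by omega, fun i' hi => ?_⟩
    rw [unbar_cons]
    cases hw with
    | nil => simp [lift_cls_one]
    | cons hx hw =>
      rw [lift_cls_cons]
      exact tmul_mem_tailPart (.cons (τ.proj_mem hx) hw) hc rfl (by omega)

theorem tailMul_line_pow_mem {n j : ℕ} {m : S.Tail} (hm : m ∈ S.tailPart n j) (q : ℕ) :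
    tailMul S (ι k τ.t ^ q) m ∈ S.tailPart (q + n) j := by
  induction q with
  | zero => simpa [tailMul_one] using hm
  | succ q ih =>
    rw [pow_succ', tailMul_cons]
    exact tailCons_mem τ.t_mem_zero ih (by omega) (by omega)

theorem tailHomotopy_of_mem {n j : ℕ} {m : S.Tail} (hm : m ∈ S.tailPart n j) :
    (j = 0 → τ.tailHomotopy m = 0) ∧ ∀ j', j = j' + 1 → τ.tailHomotopy m ∈ S.tailPart n j' := by
  induction hm using Submodule.span_induction with
  | mem z hz =>
    obtain ⟨n₁, j₁, n₂, j₂, w, c, hw, hc, rfl, rfl, rfl⟩ := hz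
    obtain ⟨r, hr, hj⟩ := τ.lineWord_of_isWord hw
    rw [tailHomotopy_tmul, hr, map_smul, LinearMap.smul_apply]
    obtain ⟨h0, h1⟩ := τ.unbar_of_isBarWord hc
    refine ⟨fun h => by simp [h0 (by omega)], fun j' hj' => ?_⟩
    by_cases h : j₁ = 0
    · exact Submodule.smul_mem _ _ (τ.tailMul_line_pow_mem (h1 _ (by omega)) _)
    · simp [hj h]
  | zero => simp
  | add u v _ _ hu hv =>
    rw [map_add]
    exact ⟨fun h => by rw [hu.1 h, hv.1 h, add_zero],
      fun j' h => add_mem (hu.2 j' h) (hv.2 j' h)⟩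
  | smul r u _ hu =>
    rw [map_smul]
    exact ⟨fun h => by rw [hu.1 h, smul_zero], fun j' h => Submodule.smul_mem _ _ (hu.2 j' h)⟩

/-- The tail `t ⊗ ⋯ ⊗ t` with `q` factors. -/
def lineTail (q : ℕ) : S.Tail := (ι k τ.t ^ q) ⊗ₜ 1

theorem lineTail_zero : τ.lineTail 0 = 1 ⊗ₜ 1 := by simp [lineTail]

theorem lineTail_succ (q : ℕ) : τ.lineTail (q + 1) = S.tailCons τ.t (τ.lineTail q) := by
  simp [lineTail, pow_succ']

theorem isWord_line_pow (q : ℕ) : IsWord 𝒜 q 0 (ι k τ.t ^ q) := by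
  induction q with
  | zero => exact pow_zero (ι k τ.t) ▸ .nil
  | succ q ih =>
    rw [pow_succ', add_comm]
    exact .cons τ.t_mem_zero ih

theorem lineTail_mem (q : ℕ) : τ.lineTail q ∈ S.tailPart q 0 :=
  tmul_mem_tailPart (τ.isWord_line_pow q) .nil rfl rfl

theorem tailD_lineTail (q : ℕ) : S.tailD (τ.lineTail q) = 0 := by
  induction q with
  | zero => simp [lineTail_zero, tailD_one, cobarD_one]
  | succ q ih => rw [lineTail_succ, tailD_tailCons_t, ih, map_zero]

theorem tailHomotopy_lineTail (q : ℕ) : τ.tailHomotopy (τ.lineTail q) = 0 := by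
  rw [lineTail, tailHomotopy_tmul, unbar_one, map_zero]

theorem tailProj_of_mem {n j : ℕ} {m : S.Tail} (hm : m ∈ S.tailPart n j) :
    ∃ r : k, τ.tailProj m = r • τ.lineTail n ∧ (j ≠ 0 → r = 0) := by
  induction hm using Submodule.span_induction with
  | mem z hz =>
    obtain ⟨n₁, j₁, n₂, j₂, w, c, hw, hc, rfl, rfl, rfl⟩ := hz
    cases hc with
    | nil =>
      obtain ⟨r, hr, hj⟩ := τ.lineWord_of_isWord hw
      exact ⟨r, by rw [tailProj_tmul, hr, map_one, one_smul]; rfl, hj⟩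
    | cons hv hc =>
      refine ⟨0, ?_, fun _ => rfl⟩
      rw [tailProj_tmul, map_mul, TensorAlgebra.algebraMapInv, TensorAlgebra.lift_ι_apply]
      simp
  | zero => exact ⟨0, by simp, fun _ => rfl⟩
  | add u v _ _ hu hv =>
    obtain ⟨r, hr, hr'⟩ := hu
    obtain ⟨s, hs, hs'⟩ := hv
    exact ⟨r + s, by rw [map_add, hr, hs, add_smul], fun h => by rw [hr' h, hs' h, add_zero]⟩
  | smul s u _ hu =>
    obtain ⟨r, hr, hr'⟩ := hu
    exact ⟨s * r, by rw [map_smul, hr, mul_smul], fun h => by rw [hr' h, mul_zero]⟩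

/-! ### The subcomplex of the words `[x ⊗ t ⊗ ⋯ ⊗ t]` -/

/-- The bar word `[x ⊗ t ⊗ ⋯ ⊗ t]` with `q` factors `t`. -/
def lineBar (q : ℕ) : R →ₗ[k] S.Cobar := S.join.flip (τ.lineTail q)

theorem lineBar_apply (q : ℕ) (x : R) : τ.lineBar q x = S.join x (τ.lineTail q) := rfl

theorem cobarD_lineBar_zero (x : R) : S.cobarD (τ.lineBar 0 x) = 0 := by
  rw [lineBar_apply, cobarD_join, tailD_lineTail, lineTail_zero, joinMul_tmul, leftMul_one]
  simp

theorem cobarD_lineBar_succ (q : ℕ) (x : R) :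
    S.cobarD (τ.lineBar (q + 1) x) = -τ.lineBar q (S.d x * τ.t) := by
  rw [lineBar_apply, cobarD_join, tailD_lineTail, map_zero, add_zero, lineTail_succ, lineTail,
    tailCons_tmul, joinMul_tmul, leftMul_cons]
  rfl

theorem homotopy_lineBar (q : ℕ) (x : R) : τ.homotopy (τ.lineBar q x) = 0 := by
  rw [lineBar_apply, homotopy_join, tailHomotopy_lineTail, map_zero]

theorem homotopy_cobarD_lineBar (q : ℕ) (x : R) :
    τ.homotopy (S.cobarD (τ.lineBar q x)) = 0 := by
  cases q with
  | zero => rw [cobarD_lineBar_zero, map_zero]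
  | succ q => rw [cobarD_lineBar_succ, map_neg, homotopy_lineBar, neg_zero]

/-- The part of weight `n` and degree `i` of the subcomplex of the words `[x ⊗ t ⊗ ⋯ ⊗ t]`. -/
def linePart (n i : ℕ) : Submodule k S.Cobar :=
  Submodule.span k {z | ∃ p q, ∃ x ∈ 𝒜 p, 1 + p + q = n ∧ p + 1 = i ∧ τ.lineBar q x = z}

theorem lineBar_mem {p q n i : ℕ} {x : R} (hx : x ∈ 𝒜 p) (hn : 1 + p + q = n)
    (hi : p + 1 = i) : τ.lineBar q x ∈ τ.linePart n i :=
  Submodule.subset_span ⟨p, q, x, hx, hn, hi, rfl⟩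

theorem exists_of_mem_linePart {n i : ℕ} {c : S.Cobar} (hc : c ∈ τ.linePart n i) :
    c = 0 ∨ ∃ p q, ∃ x ∈ 𝒜 p, 1 + p + q = n ∧ p + 1 = i ∧ τ.lineBar q x = c := by
  induction hc using Submodule.span_induction with
  | mem z hz => exact .inr hz
  | zero => exact .inl rfl
  | add u v _ _ hu hv =>
    rcases hu with rfl | ⟨p, q, x, hx, rfl, rfl, rfl⟩
    · simpa using hv
    · rcases hv with rfl | ⟨p', q', x', hx', hn, hi, rfl⟩
      · exact .inr ⟨p, q, x, hx, rfl, rfl, by simp⟩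
      · obtain rfl : p' = p := by omega
        obtain rfl : q' = q := by omega
        exact .inr ⟨p', q', x + x', add_mem hx hx', rfl, rfl, map_add _ _ _⟩
  | smul r u _ hu =>
    rcases hu with rfl | ⟨p, q, x, hx, rfl, rfl, rfl⟩
    · simp
    · exact .inr ⟨p, q, r • x, Submodule.smul_mem _ _ hx, rfl, rfl, map_smul _ _ _⟩

theorem homotopy_cobarD_of_mem_linePart {n i : ℕ} {c : S.Cobar} (hc : c ∈ τ.linePart n i) :
    τ.homotopy (S.cobarD c) = 0 := by
  rcases τ.exists_of_mem_linePart hc with rfl | ⟨p, q, x, -, -, -, rfl⟩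
  · simp
  · exact τ.homotopy_cobarD_lineBar q x

theorem homotopy_mem_headPart {a n i : ℕ} {c : S.Cobar} (hc : c ∈ S.headPart a n (i + 1)) :
    τ.homotopy c ∈ S.headPart a n i := by
  induction hc using Submodule.span_induction with
  | mem z hz =>
    obtain ⟨b, m, j, x, hx, y, hy, ha, rfl, hi, rfl⟩ := hz
    rw [homotopy_join]
    cases j with
    | zero => simp [(τ.tailHomotopy_of_mem hy).1 rfl]
    | succ j =>
      exact join_mem_headPart (parity_mem hx) ((τ.tailHomotopy_of_mem hy).2 j rfl) ha rfl
        (by omega)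
  | zero => simp
  | add u v _ _ hu hv => rw [map_add]; exact add_mem hu hv
  | smul r u _ hu => rw [map_smul]; exact Submodule.smul_mem _ _ hu

/-- Modulo bar words with a first letter of higher degree, the homotopy contracts the cobar complex
onto the subcomplex of the words `[x ⊗ t ⊗ ⋯ ⊗ t]`. -/
theorem sub_homotopy_mem {a n i : ℕ} {c : S.Cobar} (hc : c ∈ S.headPart a n i) :
    c - S.cobarD (τ.homotopy c) - τ.homotopy (S.cobarD c) ∈
      τ.linePart n i ⊔ S.headPart (a + 1) n i := by
  induction hc using Submodule.span_induction with
  | mem z hz =>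
    obtain ⟨b, m, j, x, hx, y, hy, ha, rfl, rfl, rfl⟩ := hz
    have hle : S.headPart (b + 1) (1 + b + m) (b + 1 + j) ≤
        S.headPart (a + 1) (1 + b + m) (b + 1 + j) := by
      refine Submodule.span_mono ?_
      rintro _ ⟨b', m', j', x', hx', y', hy', ha', h⟩
      exact ⟨b', m', j', x', hx', y', hy', by omega, h⟩
    rw [join_sub_cobarD_homotopy, add_assoc (S.join x _)]
    refine Submodule.add_mem_sup ?_ (hle (add_mem ?_ ?_))
    · obtain ⟨r, hr, hj⟩ := τ.tailProj_of_mem hy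
      rw [hr, map_smul]
      by_cases h : j = 0
      · exact Submodule.smul_mem _ _ (τ.lineBar_mem hx rfl (by omega))
      · simp [hj h]
    · cases j with
      | zero => simp [(τ.tailHomotopy_of_mem hy).1 rfl]
      | succ j =>
        exact joinMul_mem_headPart (S.d_mem (parity_mem hx))
          ((τ.tailHomotopy_of_mem hy).2 j rfl) (by omega) (by omega)
    · exact τ.homotopy_mem_headPart
        (joinMul_mem_headPart (S.d_mem hx) hy (by omega) (by omega))
  | zero => simp
  | add u v _ _ hu hv =>
    have := add_mem hu hv
    simp only [map_add]
    convert this using 1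
    abel
  | smul r u _ hu =>
    have := Submodule.smul_mem _ r hu
    simpa only [map_smul, smul_sub] using this

/-- The cobar complex is acyclic modulo the subcomplex of the words `[x ⊗ t ⊗ ⋯ ⊗ t]`. The
hypothesis holds if `D c` lies in that subcomplex, because the homotopy vanishes there. -/
theorem exists_add_cobarD_of_mem_headPart {a n i : ℕ} {c : S.Cobar}
    (hc : c ∈ S.headPart a n (i + 1)) (hD : τ.homotopy (S.cobarD c) = 0) :
    ∃ y ∈ τ.linePart n (i + 1), ∃ b ∈ S.cobarPart n i, c = y + S.cobarD b := by
  -- downward induction on the degree `a` of the first letter, which is at most `n - 1`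
  obtain ⟨s, hs⟩ : ∃ s, n ≤ a + s := ⟨n, by omega⟩
  induction s generalizing a c with
  | zero =>
    rw [headPart_eq_bot_of_le (by omega), Submodule.mem_bot] at hc
    exact ⟨0, zero_mem _, 0, zero_mem _, by simp [hc]⟩
  | succ s ih =>
    have h := τ.sub_homotopy_mem hc
    rw [hD, sub_zero] at h
    obtain ⟨y, hy, c', hc', h⟩ := Submodule.mem_sup.1 h
    have hD' : τ.homotopy (S.cobarD c') = 0 := by
      rw [eq_sub_of_add_eq' h, map_sub, map_sub S.cobarD c, cobarD_cobarD, sub_zero, map_sub, hD,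
        τ.homotopy_cobarD_of_mem_linePart hy, sub_zero]
    obtain ⟨y', hy', b, hb, rfl⟩ := ih hc' hD' (by omega)
    refine ⟨y + y', add_mem hy hy', b + τ.homotopy c,
      add_mem hb (headPart_le_cobarPart _ _ _ (τ.homotopy_mem_headPart hc)), ?_⟩
    refine (eq_add_of_sub_eq h.symm).trans ?_
    rw [map_add]
    abel

/-! ### The map from the Deligne complex -/

theorem linePart_le_cobarPart (n i : ℕ) : τ.linePart n i ≤ S.cobarPart n i := by
  refine le_trans (Submodule.span_le.2 ?_) (headPart_le_cobarPart 0 n i)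
  rintro _ ⟨p, q, x, hx, hn, hi, rfl⟩
  exact join_mem_headPart hx (τ.lineTail_mem q) (Nat.zero_le _) hn hi

theorem tinv_pow_mul_t_pow (q : ℕ) : τ.tinv ^ q * τ.t ^ q = 1 := by
  rw [← (τ.commute_t τ.tinv).symm.mul_pow, τ.tinv_mul_t, one_pow]

theorem d_mul_tinv_pow (x : R) (q : ℕ) : S.d (x * τ.tinv ^ q) = S.d x * τ.tinv ^ q := by
  induction q with
  | zero => simp
  | succ q ih => rw [pow_succ, ← mul_assoc, S.d_mul, τ.d_tinv, mul_zero, add_zero, ih, mul_assoc]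

theorem mul_tinv_pow_mem {p : ℕ} {x : R} (hx : x ∈ 𝒜 p) (q : ℕ) : x * τ.tinv ^ q ∈ 𝒜 p := by
  have h : τ.tinv ^ q ∈ 𝒜 0 := by simpa using SetLike.pow_mem_graded q τ.tinv_mem
  simpa using SetLike.mul_mem_graded hx h

/-- The map `x ↦ (-1) ^ p [x t ^ (-q) ⊗ t ⊗ ⋯ ⊗ t]` on `R ^ p`, with `q = n - 1 - p` factors `t`. -/
def deligneBar (n p : ℕ) : R →ₗ[k] S.Cobar :=
  (-1 : k) ^ p • τ.lineBar (n - 1 - p) ∘ₗ LinearMap.mulRight k (τ.tinv ^ (n - 1 - p))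

theorem deligneBar_apply (n p : ℕ) (x : R) :
    τ.deligneBar n p x =
      (-1 : k) ^ p • τ.lineBar (n - 1 - p) (x * τ.tinv ^ (n - 1 - p)) := rfl

theorem deligneBar_mem {n p : ℕ} {x : R} (hx : x ∈ S.deligneTerm n p) :
    τ.deligneBar n p x ∈ S.cobarPart n (p + 1) := by
  rw [deligneTerm] at hx
  split_ifs at hx with h
  · exact τ.linePart_le_cobarPart _ _ (Submodule.smul_mem _ _
      (τ.lineBar_mem (τ.mul_tinv_pow_mem hx _) (by omega) rfl))
  · rw [(Submodule.mem_bot k).1 hx, map_zero]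
    exact zero_mem _

theorem cobarD_deligneBar (n p : ℕ) (x : S.deligneTerm n p) :
    S.cobarD (τ.deligneBar n p x) = τ.deligneBar n (p + 1) (S.deligneD n p x) := by
  obtain ⟨x, hx⟩ := x
  rw [deligneD]
  split_ifs with h
  · obtain ⟨q, rfl⟩ : ∃ q, n = q + (p + 1 + 1) := ⟨n - (p + 1 + 1), by omega⟩
    rw [deligneBar_apply, deligneBar_apply, show q + (p + 1 + 1) - 1 - p = q + 1 by omega,
      show q + (p + 1 + 1) - 1 - (p + 1) = q by omega, map_smul, cobarD_lineBar_succ,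
      d_mul_tinv_pow, pow_succ, mul_assoc, mul_assoc, τ.tinv_mul_t, mul_one, pow_succ, smul_neg,
      mul_neg_one, neg_smul]
    rfl
  · rw [LinearMap.zero_apply, ZeroMemClass.coe_zero, map_zero, deligneBar_apply,
      show n - 1 - p = 0 by omega, map_smul, cobarD_lineBar_zero, smul_zero]

/-- In degrees below `n`, the kernel of `deligneBar` is the line spanned by `t ^ n`. -/
theorem exists_of_deligneBar_eq_zero {n p : ℕ} (hp : p < n) {x : R}
    (h : τ.deligneBar n p x = 0) : ∃ c : k, x = c • τ.t ^ (n - p) ∧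
      c = τ.φ (x * τ.tinv ^ (n - 1 - p)) := by
  obtain ⟨q, rfl⟩ : ∃ q, n = q + (p + 1) := ⟨n - (p + 1), by omega⟩
  rw [deligneBar_apply] at h
  rw [show q + (p + 1) - 1 - p = q by omega] at h ⊢
  rw [show q + (p + 1) - p = q + 1 by omega]
  set y := x * τ.tinv ^ q with hy
  have hc : S.cls (ι k y * ι k τ.t ^ q) = 0 := by
    have h' := (smul_eq_zero_iff_right (pow_ne_zero p (neg_ne_zero.2 (one_ne_zero (α := k))))).1 h
    rwa [lineBar_apply, lineTail, join_tmul, mul_one, ← map_zero (ι k), TensorAlgebra.ι_inj] at h'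
  -- lift to `T(R)` and multiply out the letters in `R`
  have hm := congrArg (TensorAlgebra.lift k (LinearMap.id : R →ₗ[k] R)) (congrArg τ.lift hc)
  rw [lift_cls_cons, map_zero, map_zero, map_mul, map_pow, TensorAlgebra.lift_ι_apply,
    TensorAlgebra.lift_ι_apply, LinearMap.id_apply, LinearMap.id_apply] at hm
  have hpow : τ.t ^ q * τ.tinv ^ q = 1 := by
    rw [← (τ.commute_t τ.tinv).mul_pow, τ.t_mul_tinv, one_pow]
  have hproj : τ.proj y = 0 := by
    rw [← mul_one (τ.proj y), ← hpow, ← mul_assoc, hm, zero_mul]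
  refine ⟨τ.φ y, ?_, rfl⟩
  calc x = y * τ.t ^ q := by rw [hy, mul_assoc, tinv_pow_mul_t_pow, mul_one]
    _ = (τ.φ y • τ.t) * τ.t ^ q := congrArg (· * τ.t ^ q) (sub_eq_zero.1 hproj)
    _ = τ.φ y • τ.t ^ (q + 1) := by rw [smul_mul_assoc, pow_succ']

theorem eq_zero_of_deligneBar_eq_zero {n p : ℕ} {x : R} (hx : x ∈ S.deligneTerm n (p + 1))
    (h : τ.deligneBar n (p + 1) x = 0) : x = 0 := by
  rw [deligneTerm] at hx
  split_ifs at hx with hp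
  · obtain ⟨c, hc, hc'⟩ := τ.exists_of_deligneBar_eq_zero hp h
    rw [τ.φ_of_mem (τ.mul_tinv_pow_mem hx _)] at hc'
    rw [hc, hc', zero_smul]
  · exact (Submodule.mem_bot k).1 hx

/-- The linear functional `s₁ ⊗ ⋯ ⊗ sₙ ↦ φ s₁ ⋯ φ sₙ` on `k(n)`. -/
def lineCoord (n : ℕ) : (⨂[k]^n S.line) →ₗ[k] k :=
  PiTensorProduct.lift
    ((MultilinearMap.mkPiAlgebraFin k n k).compLinearMap fun _ => τ.φ ∘ₗ S.line.subtype)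

/-- The generator `t ⊗ ⋯ ⊗ t` of `k(n)`. -/
def lineGen (n : ℕ) : ⨂[k]^n S.line := PiTensorProduct.tprod k fun _ => ⟨τ.t, τ.t_mem⟩

theorem lineCoord_lineGen (n : ℕ) : τ.lineCoord n (τ.lineGen n) = 1 := by
  simp [lineCoord, lineGen, τ.φ_t]

theorem lineMul_lineGen (n : ℕ) : S.lineMul n (τ.lineGen n) = τ.t ^ n := by
  simp [lineMul, lineGen]

theorem eq_lineCoord_smul (n : ℕ) (z : ⨂[k]^n S.line) : z = τ.lineCoord n z • τ.lineGen n := by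
  induction z using PiTensorProduct.induction_on with
  | smul_tprod r f =>
    have hf : ∀ i, ∃ c : k, f i = c • (⟨τ.t, τ.t_mem⟩ : S.line) := fun i => by
      obtain ⟨c, hc⟩ := τ.exists_smul_t (f i).2
      exact ⟨c, Subtype.ext hc⟩
    choose c hc using hf
    have h : PiTensorProduct.tprod k f = (∏ i, c i) • τ.lineGen n := by
      rw [funext hc, MultilinearMap.map_smul_univ]
      rfl
    rw [h, smul_smul, map_smul, lineCoord_lineGen, smul_eq_mul, mul_one]
  | add a b ha hb => rw [map_add, add_smul, ← ha, ← hb]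

/-- The degree `0` part `k(n) → Cobar` of the map from the Deligne complex: the isomorphism with
`k` if `n = 0`, and zero otherwise. -/
def deligneUnit (n : ℕ) : (⨂[k]^n S.line) →ₗ[k] S.cobarPart n 0 :=
  if h : n = 0 then
    ((τ.lineCoord n).smulRight (1 : S.Cobar)).codRestrict _ fun z => by
      subst h
      exact Submodule.smul_mem _ _ IsBarWord.nil.mem
  else 0

theorem cobarD_deligneUnit (n : ℕ) (z : ⨂[k]^n S.line) :
    S.cobarD (τ.deligneUnit n z) = τ.deligneBar n 0 (S.deligneAug n z) := by
  rw [deligneUnit, deligneAug]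
  split_ifs with h h' h'
  · omega
  · simp [cobarD_one]
  · rw [LinearMap.zero_apply, ZeroMemClass.coe_zero, map_zero]
    change 0 = τ.deligneBar n 0 (S.lineMul n z)
    obtain ⟨q, rfl⟩ : ∃ q, n = q + 1 := ⟨n - 1, by omega⟩
    rw [τ.eq_lineCoord_smul _ z, map_smul, map_smul, lineMul_lineGen, deligneBar_apply,
      show q + 1 - 1 - 0 = q by omega, pow_succ', mul_assoc,
      ← (τ.commute_t τ.tinv).mul_pow, τ.t_mul_tinv, one_pow, mul_one, lineBar_apply,
      S.join_of_mem_line τ.t_mem, smul_zero, smul_zero]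
  · omega

open CategoryTheory

theorem deligneComplex_d (S : TateDGAlgebra 𝒜) (n i : ℕ) :
    (S.deligneComplex n).d i (i + 1) = S.deligneDiff n i := CochainComplex.of_d _ _ _

theorem cobarComplex_d (S : TateDGAlgebra 𝒜) (n i : ℕ) :
    (S.cobarComplex n).d i (i + 1) =
      ModuleCat.ofHom (S.cobarD.restrict fun _ hc => S.cobarD_mem hc) :=
  CochainComplex.of_d (fun i => ModuleCat.of k (S.cobarPart n i))
    (fun _ => ModuleCat.ofHom (S.cobarD.restrict fun _ hc => S.cobarD_mem hc)) i

/-- The components of the map from the Deligne complex to the cobar complex. -/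
def deligneMapX (n : ℕ) : (i : ℕ) → (S.deligneX n i ⟶ ModuleCat.of k (S.cobarPart n i))
  | 0 => ModuleCat.ofHom (τ.deligneUnit n)
  | p + 1 => ModuleCat.ofHom
      (((τ.deligneBar n p).comp (S.deligneTerm n p).subtype).codRestrict _
        fun x => τ.deligneBar_mem x.2)

/-- The map from the Deligne complex to the cobar complex. -/
def deligneMap (n : ℕ) : S.deligneComplex n ⟶ S.cobarComplex n :=
  CochainComplex.ofHom (τ.deligneMapX n) fun i => by
    rw [deligneComplex_d, cobarComplex_d]
    cases i with
    | zero =>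
      exact ModuleCat.hom_ext (LinearMap.ext fun z => Subtype.ext (τ.cobarD_deligneUnit n z))
    | succ p =>
      exact ModuleCat.hom_ext (LinearMap.ext fun x => Subtype.ext (τ.cobarD_deligneBar n p x))

/-! ### The quasi-isomorphism -/

theorem cobarPart_zero_eq_bot {n : ℕ} (hn : n ≠ 0) : S.cobarPart n 0 = ⊥ :=
  le_bot_iff.1 (headPart_degree_zero (S := S) 0 n ▸ cobarPart_le_headPart hn 0)

theorem isBarWord_of_weight_zero {n i : ℕ} {c : S.Cobar} (hc : S.IsBarWord n i c) (hn : n = 0) :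
    c = 0 ∨ i = 0 ∧ c = 1 := by
  cases hc with
  | nil => exact .inr ⟨rfl, rfl⟩
  | cons hw hc =>
    cases hw with
    | nil => simp [cls_one]
    | cons hx hw => omega

theorem cobarPart_zero_zero_le : S.cobarPart 0 0 ≤ Submodule.span k {1} := by
  refine Submodule.span_le.2 fun c hc => ?_
  rcases isBarWord_of_weight_zero hc rfl with rfl | ⟨-, rfl⟩
  · exact zero_mem _
  · exact Submodule.mem_span_singleton_self _

theorem deligneUnit_zero_injective {z : ⨂[k]^0 S.line} (h : τ.deligneUnit 0 z = 0) : z = 0 := by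
  have h' : τ.lineCoord 0 z • (1 : S.Cobar) = 0 := congrArg Subtype.val h
  have h1 := congrArg TensorAlgebra.algebraMapInv h'
  rw [map_smul, map_one, map_zero, smul_eq_mul, mul_one] at h1
  rw [τ.eq_lineCoord_smul 0 z, h1, zero_smul]

theorem deligneUnit_zero_surjective (c : S.cobarPart 0 0) : ∃ z, τ.deligneUnit 0 z = c := by
  obtain ⟨r, hr⟩ := Submodule.mem_span_singleton.1 (cobarPart_zero_zero_le c.2)
  refine ⟨r • τ.lineGen 0, Subtype.ext ?_⟩
  change τ.lineCoord 0 (r • τ.lineGen 0) • (1 : S.Cobar) = c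
  rw [map_smul, lineCoord_lineGen, smul_eq_mul, mul_one, hr]

theorem cobarPart_zero_succ (i : ℕ) : S.cobarPart 0 (i + 1) = ⊥ := by
  rw [cobarPart, Submodule.span_eq_bot]
  intro c hc
  rcases isBarWord_of_weight_zero hc rfl with rfl | ⟨h, -⟩
  · rfl
  · omega

theorem deligneAug_weight_zero (z : ⨂[k]^0 S.line) : S.deligneAug 0 z = 0 := by
  rw [deligneAug, dif_neg (lt_irrefl 0), LinearMap.zero_apply]

theorem deligneAug_injective {n : ℕ} (hn : 0 < n) {z : ⨂[k]^n S.line}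
    (h : S.deligneAug n z = 0) : z = 0 := by
  obtain ⟨τ⟩ := S.exists_trivialization
  rw [deligneAug, dif_pos hn] at h
  have h' : S.lineMul n z = 0 := congrArg Subtype.val h
  rw [τ.eq_lineCoord_smul n z, map_smul, lineMul_lineGen] at h'
  have h1 := congrArg (τ.tinv ^ n * ·) h'
  simp only [mul_smul_comm, τ.tinv_pow_mul_t_pow, mul_zero] at h1
  have hR : (1 : R) ≠ 0 := fun h => τ.t_ne_zero (by rw [← mul_one τ.t, h, mul_zero])
  rw [τ.eq_lineCoord_smul n z, (smul_eq_zero.1 h1).resolve_right hR, zero_smul]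

/-- An element of the cobar complex whose coboundary is zero, or comes from the Deligne complex,
itself comes from the Deligne complex up to a coboundary. -/
theorem exists_deligneBar_add_cobarD {n p : ℕ} {c : S.Cobar} (hc : c ∈ S.cobarPart n (p + 1))
    (hD : τ.homotopy (S.cobarD c) = 0) : ∃ x ∈ S.deligneTerm n p, ∃ b ∈ S.cobarPart n p,
      c = τ.deligneBar n p x + S.cobarD b := by
  rcases eq_or_ne n 0 with rfl | hn
  · rw [cobarPart_zero_succ, Submodule.mem_bot] at hc
    exact ⟨0, zero_mem _, 0, zero_mem _, by simp [hc]⟩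
  · obtain ⟨y, hy, b, hb, rfl⟩ :=
      τ.exists_add_cobarD_of_mem_headPart (cobarPart_le_headPart hn _ hc) hD
    rcases τ.exists_of_mem_linePart hy with rfl | ⟨p', q, x, hx, rfl, hi, rfl⟩
    · exact ⟨0, zero_mem _, b, hb, by simp⟩
    · obtain rfl : p' = p := by omega
      refine ⟨(-1 : k) ^ p' • (x * τ.t ^ q), ?_, b, hb, ?_⟩
      · rw [deligneTerm, if_pos (by omega)]
        have h : τ.t ^ q ∈ 𝒜 0 := by simpa using SetLike.pow_mem_graded q τ.t_mem_zero
        exact Submodule.smul_mem _ _ (by simpa using SetLike.mul_mem_graded hx h)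
      · rw [map_smul, deligneBar_apply, smul_smul, ← mul_pow, neg_one_mul, neg_neg, one_pow,
          one_smul, show 1 + p' + q - 1 - p' = q by omega, mul_assoc,
          ← (τ.commute_t τ.tinv).mul_pow, τ.t_mul_tinv, one_pow, mul_one]

theorem homotopy_deligneBar (n p : ℕ) (x : R) : τ.homotopy (τ.deligneBar n p x) = 0 := by
  rw [deligneBar_apply, map_smul, homotopy_lineBar, smul_zero]

theorem exists_deligneD_eq {n p : ℕ} {x : S.deligneTerm n (p + 1)} {b : S.Cobar}
    (hb : b ∈ S.cobarPart n (p + 1)) (h : τ.deligneBar n (p + 1) x = S.cobarD b) :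
    ∃ z, x = S.deligneD n p z := by
  obtain ⟨y, hy, b', -, rfl⟩ := τ.exists_deligneBar_add_cobarD hb
    (by rw [← h, homotopy_deligneBar])
  refine ⟨⟨y, hy⟩, ?_⟩
  rw [map_add, cobarD_cobarD, add_zero, τ.cobarD_deligneBar n p ⟨y, hy⟩, ← sub_eq_zero,
    ← map_sub] at h
  exact sub_eq_zero.1 (Subtype.ext (τ.eq_zero_of_deligneBar_eq_zero
    (sub_mem x.2 (S.deligneD n p ⟨y, hy⟩).2) h))

theorem exists_deligneAug_eq {n : ℕ} {x : S.deligneTerm n 0} {b : S.Cobar}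
    (hb : b ∈ S.cobarPart n 0) (h : τ.deligneBar n 0 x = S.cobarD b) :
    ∃ z, x = S.deligneAug n z := by
  obtain ⟨x, hx⟩ := x
  rcases Nat.eq_zero_or_pos n with rfl | hn
  · refine ⟨0, Subtype.ext ?_⟩
    rw [deligneTerm, if_neg (lt_irrefl 0), Submodule.mem_bot] at hx
    simpa using hx
  · rw [cobarPart_zero_eq_bot hn.ne', Submodule.mem_bot] at hb
    rw [hb, map_zero] at h
    obtain ⟨c, hc, -⟩ := τ.exists_of_deligneBar_eq_zero hn h
    refine ⟨c • τ.lineGen n, Subtype.ext ?_⟩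
    rw [deligneAug, dif_pos hn]
    change x = S.lineMul n (c • τ.lineGen n)
    rw [map_smul, lineMul_lineGen]
    exact hc

theorem deligneD_eq_zero {n p : ℕ} {x : S.deligneTerm n p} {b c : S.Cobar}
    (h : c = τ.deligneBar n p x + S.cobarD b) (hc : S.cobarD c = 0) : S.deligneD n p x = 0 := by
  rw [h, map_add, cobarD_cobarD, add_zero, cobarD_deligneBar] at hc
  exact Subtype.ext (τ.eq_zero_of_deligneBar_eq_zero (S.deligneD n p x).2 hc)

theorem quasiIso_deligneMap (n : ℕ) : QuasiIso (τ.deligneMap n) := by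
  rw [quasiIso_iff]
  intro i
  match i with
  | 0 =>
    refine HomologicalComplex.quasiIsoAt_of_elements _ CochainComplex.prev_nat_zero
      (CochainComplex.next _ _) ?_ ?_
    · intro z hz y hy
      rw [deligneComplex_d] at hz
      refine ⟨0, ?_⟩
      rw [map_zero]
      rcases Nat.eq_zero_or_pos n with rfl | hn
      · exact τ.deligneUnit_zero_injective (hy.trans (by
          rw [HomologicalComplex.shape _ _ _ (by simp)]; rfl))
      · exact deligneAug_injective hn hz
    · intro y _
      rcases Nat.eq_zero_or_pos n with rfl | hn
      · obtain ⟨z, hz⟩ := τ.deligneUnit_zero_surjective y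
        refine ⟨z, ?_, 0, ?_⟩
        · rw [deligneComplex_d]
          exact deligneAug_weight_zero z
        · rw [map_zero, add_zero]
          exact hz.symm
      · have hy : y = 0 :=
          Subtype.ext ((Submodule.mem_bot k).1 (cobarPart_zero_eq_bot (S := S) hn.ne' ▸ y.2))
        exact ⟨0, map_zero _, 0, by rw [hy, map_zero, map_zero, add_zero]⟩
  | 1 =>
    refine HomologicalComplex.quasiIsoAt_of_elements _ (CochainComplex.prev_nat_succ 0)
      (CochainComplex.next _ _) ?_ ?_
    · intro x hx y hy
      rw [cobarComplex_d] at hy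
      rw [deligneComplex_d]
      exact τ.exists_deligneAug_eq y.2 (congrArg Subtype.val hy)
    · intro y hy
      rw [cobarComplex_d] at hy
      have hy' := congrArg Subtype.val hy
      obtain ⟨x, hx, b, hb, h⟩ := τ.exists_deligneBar_add_cobarD y.2
        ((congrArg τ.homotopy hy').trans (map_zero _))
      refine ⟨⟨x, hx⟩, ?_, ⟨b, hb⟩, ?_⟩
      · rw [deligneComplex_d]
        exact τ.deligneD_eq_zero (x := ⟨x, hx⟩) h hy'
      · rw [cobarComplex_d]
        exact Subtype.ext h
  | p + 2 =>
    refine HomologicalComplex.quasiIsoAt_of_elements _ (CochainComplex.prev_nat_succ (p + 1))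
      (CochainComplex.next _ _) ?_ ?_
    · intro x hx y hy
      rw [cobarComplex_d] at hy
      rw [deligneComplex_d]
      exact τ.exists_deligneD_eq y.2 (congrArg Subtype.val hy)
    · intro y hy
      rw [cobarComplex_d] at hy
      have hy' := congrArg Subtype.val hy
      obtain ⟨x, hx, b, hb, h⟩ := τ.exists_deligneBar_add_cobarD y.2
        ((congrArg τ.homotopy hy').trans (map_zero _))
      refine ⟨⟨x, hx⟩, ?_, ⟨b, hb⟩, ?_⟩
      · rw [deligneComplex_d]
        exact τ.deligneD_eq_zero (x := ⟨x, hx⟩) h hy'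
      · rw [cobarComplex_d]
        exact Subtype.ext h

end Trivialization

end TateDGAlgebra

end TateDG

end

theorem theorem2p11 {k R : Type u} [Field k] [Ring R] [Algebra k R]
    (𝒜 : ℕ → Submodule k R) [GradedAlgebra 𝒜] (S : TateDG.TateDGAlgebra 𝒜)
    (hcomm : TateDG.GradedCommutative 𝒜) (n : ℕ) :
    ∃ f : S.deligneComplex n ⟶ S.cobarComplex n, QuasiIso f := by
  obtain ⟨τ⟩ := S.exists_trivialization
  exact ⟨τ.deligneMap n, τ.quasiIso_deligneMap n⟩
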